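/- Let $X$ be a finite-dimensional complex Banach space and $[0,1]\ni s\mapsto L(s)\in\mathcal B(X)$ (with the operator norm). For an isolated point $e$ of $\mathrm{sp}\,L(s)$, the spectral projector on $e$ is $\frac1{2\pi i}\oint(z-L(s))^{-1}dz$ over a small positively oriented circle around $e$. Let $P(s)$ be the sum of the spectral projectors of $L(s)$ on its peripheral eigenvalues, i.e. the points of $\mathrm{sp}\,L(s)\cap S^1$, and $Q(s)=\mathrm{Id}-P(s)$. Assume: (H1) $\|L(s)\|\le 1$ for all $s\in[0,1]$; (H2) there is $\epsilon>0$ such that, for all $s\in[0,1]$, every peripheral eigenvalue of $L(s)$ is simple and any two distinct ones are at distance $>2\epsilon$; (H3) $s\mapsto L(s)P(s)$ is $C^2$ on $[0,1]$; (H4) $\ell:=\sup_{s\in[0,1]}\|L(s)Q(s)\|<1$. Let $N$ be the maximum over $s\in[0,1]$ of the number of peripheral eigenvalues of $L(s)$. Then the peripheral eigenvalues of $L(s)$, $s\in[0,1]$, can be labelled without repetition as $e^1(s),\dots,e^N(s)$ with each $e^j$ continuous on $[0,1]$. For every such labelling, with $P^j(s)$ the spectral projector of $L(s)$ on $e^j(s)$,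 the functions $e^j$ and $P^j$ are $C^2$ on $[0,1]$; in particular there is $c\ge0$ that bounds $|\frac{d^\alpha e^j}{ds^\alpha}(s)|$ and $\|\frac{d^\alpha P^j}{ds^\alpha}(s)\|$ for all $s\in[0,1]$, all $j$ and $\alpha=1,2$. Fix such a $c$. For $T\in\mathbb N$, $T\ge1$, and $0\le k\le T$ write $L_k=L(k/T)$, $P_k=P(k/T)$, $Q_k=Q(k/T)$, $P^j_k=P^j(k/T)$, $e^j_k=e^j(k/T)$, $L^P_k=L_kP_k$, $L^Q_k=L_kQ_k$, and put $$\kappa_{k}=\sum_jP^j_{k}P^j_{k-1}\big(\mathrm{Id}-(P^j_{k}-P^j_{k-1})^2\big)^{-1/2},\qquad \kappa_{k}^\dagger=\sum_jP^j_{k-1}P^j_{k}\big(\mathrm{Id}-(P^j_{k}-P^j_{k-1})^2\big)^{-1/2}\qquad(1\le k\le T),$$ where $(\mathrm{Id}-B)^{-1/2}=\sum_n\binom{2n}{n}4^{-n}B^n$ for $\|B\|<1$, and, for $0\le k\le T$ (empty products being the identity), $$A_{k,T}=\kappa_k\cdots\kappa_1\sum_j\Big(\prod_{n=1}^ke^j_n\Big)P^j_0,\qquad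 A_{k,T}^\dagger=\Big(\sum_j\Big(\prod_{n=1}^k\overline{e^j_n}\Big)P^j_0\Big)\kappa_1^\dagger\cdots\kappa_k^\dagger .$$ There are constants $T_0>c$, $T_0>0$, and $C_0>0$, depending only on $c$ and $N$, and $C>0$, depending only on $c$, $N$ and $\epsilon$, such that for all integers $T\ge T_0$ one has $\|P^j_{k}-P^j_{k-1}\|<1$ for $1\le k\le T$ and all $j$ (so that the maps above are well defined), and for all $0\le k\le T$: $$\max(\|A_{k,T}\|,\|A_{k,T}^\dagger\|)\le N\Big(1-\frac{c^2}{T_0^2}\Big)^{-T_0/2},$$ $$A_{k,T}^\dagger A_{k,T}=P_0,\quad A_{k,T}A_{k,T}^\dagger=P_k,\quad A_{k,T}P^j_0=P^j_kA_{k,T},\quad A_{k,T}^\dagger P^j_k=P^j_0A_{k,T}^\dagger,\quad A_{k,T}Q_0=Q_0A_{k,T}^\dagger=0,$$ $$\|L_k\cdots L_1-A_{k,T}\|\le\frac{C}{T(1-\ell)}+2\ell^k,\qquad \|L^P_k\cdots L^P_1P_0-A_{k,T}\|\le\frac CT,$$ $$\|L_k\cdots L_1-L^P_k\cdots L^P_1P_0-L^Q_k\cdots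 L^Q_1Q_0\|\le\frac{C_0}{T(1-\ell)},\qquad \|L^Q_k\cdots L^Q_1Q_0\|\le2\ell^k,$$ $$\|L_k\cdots L_1P_0-L^P_k\cdots L^P_1P_0\|\le\frac{C_0}{T(1-\ell)},\qquad \|L_k\cdots L_1Q_0\|\le\frac{C_0}{T(1-\ell)}+2\ell^k,$$ where $\ell^0=1$. -/

import Mathlib

open Set

noncomputable section

namespace Adiabatic

variable {X : Type*} [NormedAddCommGroup X] [NormedSpace ℂ X]

/-- The peripheral spectrum `sp A ∩ S¹`. -/
def peripheralSpectrum (A : X →L[ℂ] X) : Set ℂ :=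
  spectrum ℂ A ∩ Metric.sphere 0 1

/-- Half the distance from `μ` to the rest of the spectrum of `A`, capped at `1 / 2`
(the distance is `⊤` when there is no other point): the circle of this radius around an isolated
point `μ` of the spectrum encircles `μ` and no other point of the spectrum. -/
def isolatingRadius (A : X →L[ℂ] X) (μ : ℂ) : ℝ :=
  (min 1 (Metric.infEDist μ (spectrum ℂ A \ {μ}))).toReal / 2

/-- The spectral projector of `A` on `{μ}`: `(2πi)⁻¹ ∮ (z - A)⁻¹ dz` over a positively oriented
circle encircling `μ` and no other point of the spectrum. -/
def spectralProj (A : X →L[ℂ] X) (μ : ℂ) : X →L[ℂ] X :=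
  (2 * Real.pi * Complex.I : ℂ)⁻¹ • ∮ z in C(μ, isolatingRadius A μ), resolvent A z

/-- The peripheral spectral projector `P = ∑_j P^j`. -/
def peripheralProj (A : X →L[ℂ] X) : X →L[ℂ] X :=
  ∑ᶠ μ ∈ peripheralSpectrum A, spectralProj A μ

/-- The complementary projector `Q = Id - P`. -/
def stableProj (A : X →L[ℂ] X) : X →L[ℂ] X :=
  1 - peripheralProj A

/-- The hypotheses on `s ↦ L s`, `s ∈ [0,1]`, with gap `ε` and contraction constant `ℓ`. -/
structure Hypotheses (L : ℝ → X →L[ℂ] X) (ε ℓ : ℝ) : Prop where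
  contraction : ∀ s ∈ Icc (0 : ℝ) 1, ‖L s‖ ≤ 1
  gap_pos : 0 < ε
  /-- each peripheral eigenvalue has algebraic multiplicity one -/
  simple : ∀ s ∈ Icc (0 : ℝ) 1, ∀ μ ∈ peripheralSpectrum (L s),
    Module.finrank ℂ (Module.End.maxGenEigenspace (L s : X →ₗ[ℂ] X) μ) = 1
  gap : ∀ s ∈ Icc (0 : ℝ) 1, ∀ μ ∈ peripheralSpectrum (L s), ∀ ν ∈ peripheralSpectrum (L s),
    μ ≠ ν → 2 * ε < ‖μ - ν‖
  contDiffOn : ContDiffOn ℝ 2 (fun s => L s * peripheralProj (L s)) (Icc 0 1)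
  isLUB : IsLUB ((fun s => ‖L s * stableProj (L s)‖) '' Icc (0 : ℝ) 1) ℓ
  lt_one : ℓ < 1

/-- `N_max = sup_s N(s)`, with `N(s)` the number of peripheral eigenvalues of `L s`
(at most `dim X`). -/
def maxCount (L : ℝ → X →L[ℂ] X) : ℕ :=
  ⨆ s : Icc (0 : ℝ) 1, (peripheralSpectrum (L s)).ncard

/-- A continuous labelling `e^1(s), …, e^N(s)`, without repetition, of the peripheral eigenvalues
of `L s` for `s ∈ [0,1]`. -/
structure IsLabelling (L : ℝ → X →L[ℂ] X) {N : ℕ} (e : Fin N → ℝ → ℂ) : Prop where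
  continuousOn : ∀ j, ContinuousOn (e j) (Icc 0 1)
  injective : ∀ s ∈ Icc (0 : ℝ) 1, Function.Injective fun j => e j s
  range_eq : ∀ s ∈ Icc (0 : ℝ) 1, range (fun j => e j s) = peripheralSpectrum (L s)

/-- The spectral projector `P^j(s)` of `L s` on the eigenvalue `e^j(s)`. -/
def eigProj (L : ℝ → X →L[ℂ] X) {N : ℕ} (e : Fin N → ℝ → ℂ) (j : Fin N) (s : ℝ) : X →L[ℂ] X :=
  spectralProj (L s) (e j s)

/-- `c` bounds the first and second derivatives of all `P^j` and `e^j` on `[0,1]`. -/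
def DerivBound (L : ℝ → X →L[ℂ] X) {N : ℕ} (e : Fin N → ℝ → ℂ) (c : ℝ) : Prop :=
  ∀ s ∈ Icc (0 : ℝ) 1, ∀ j, ∀ α ∈ Icc 1 2,
    ‖iteratedDerivWithin α (eigProj L e j) (Icc 0 1) s‖ ≤ c ∧
    ‖iteratedDerivWithin α (e j) (Icc 0 1) s‖ ≤ c

/-- `(Id - B)^(-1/2)` through its power series `∑ (2n choose n) 4⁻ⁿ Bⁿ`, which converges
absolutely for `‖B‖ < 1`. -/
def invSqrtOneSub (B : X →L[ℂ] X) : X →L[ℂ] X :=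
  ∑' n : ℕ, ((Nat.centralBinom n : ℂ) / 4 ^ n) • B ^ n

/-- The ordered product `M k * M (k - 1) * ⋯ * M 1`. -/
def orderedProd (M : ℕ → X →L[ℂ] X) : ℕ → X →L[ℂ] X
  | 0 => 1
  | k + 1 => M (k + 1) * orderedProd M k

/-- The ordered product `M 1 * M 2 * ⋯ * M k`. -/
def revOrderedProd (M : ℕ → X →L[ℂ] X) : ℕ → X →L[ℂ] X
  | 0 => 1
  | k + 1 => revOrderedProd M k * M (k + 1)

section Families

variable (L : ℝ → X →L[ℂ] X) {N : ℕ} (e : Fin N → ℝ → ℂ) (T : ℕ)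

/-- `P^j_{k,T} = P^j(k/T)`. -/
def eigProjAt (j : Fin N) (k : ℕ) : X →L[ℂ] X := eigProj L e j (k / T : ℝ)

/-- The one-step Kato map from step `k - 1` to step `k` (used for `1 ≤ k`):
`∑_j P^j_k P^j_{k-1} (Id - (P^j_k - P^j_{k-1})²)^(-1/2)`. -/
def katoStep (k : ℕ) : X →L[ℂ] X :=
  ∑ j, eigProjAt L e T j k * eigProjAt L e T j (k - 1) *
    invSqrtOneSub ((eigProjAt L e T j k - eigProjAt L e T j (k - 1)) ^ 2)

/-- The one-step Kato map back from step `k` to step `k - 1`. -/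
def katoStepDagger (k : ℕ) : X →L[ℂ] X :=
  ∑ j, eigProjAt L e T j (k - 1) * eigProjAt L e T j k *
    invSqrtOneSub ((eigProjAt L e T j k - eigProjAt L e T j (k - 1)) ^ 2)

/-- The accumulated phases `∑_j (∏_{n=1}^k e^j_{n,T}) P^j_0`. -/
def phase (k : ℕ) : X →L[ℂ] X :=
  ∑ j, (∏ n ∈ Finset.Icc 1 k, e j (n / T : ℝ)) • eigProjAt L e T j 0

/-- The conjugate phases `∑_j (∏_{n=1}^k conj e^j_{n,T}) P^j_0`. -/
def phaseDagger (k : ℕ) : X →L[ℂ] X :=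
  ∑ j, (∏ n ∈ Finset.Icc 1 k, (starRingEnd ℂ) (e j (n / T : ℝ))) • eigProjAt L e T j 0

/-- The adiabatic approximation `A_{k,T}`. -/
def adiabaticMap (k : ℕ) : X →L[ℂ] X :=
  orderedProd (katoStep L e T) k * phase L e T k

/-- The pseudo-inverse `A†_{k,T}`. -/
def adiabaticMapDagger (k : ℕ) : X →L[ℂ] X :=
  phaseDagger L e T k * revOrderedProd (katoStepDagger L e T) k

/-- `L_{k,T} = L(k/T)`. -/
def mapAt (k : ℕ) : X →L[ℂ] X := L (k / T : ℝ)

/-- `P_{k,T} = P(k/T)`. -/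
def projAt (k : ℕ) : X →L[ℂ] X := peripheralProj (mapAt L T k)

/-- `Q_{k,T} = Id - P(k/T)`. -/
def stableAt (k : ℕ) : X →L[ℂ] X := stableProj (mapAt L T k)

/-- `L_{k,T} ⋯ L_{1,T}`. -/
def evolution (k : ℕ) : X →L[ℂ] X := orderedProd (mapAt L T) k

/-- `L^P_{k,T} ⋯ L^P_{1,T}` with `L^P = L P`. -/
def evolutionP (k : ℕ) : X →L[ℂ] X := orderedProd (fun n => mapAt L T n * projAt L T n) k

/-- `L^Q_{k,T} ⋯ L^Q_{1,T}` with `L^Q = L Q`. -/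
def evolutionQ (k : ℕ) : X →L[ℂ] X := orderedProd (fun n => mapAt L T n * stableAt L T n) k

end Families

end Adiabatic

end

/-!
The peripheral projections `P^j` have norm at most one by the mean ergodic theorem, and so does
their sum `P`, a limit of powers of `L` by (H4). Lagrange interpolation recovers `P^j` from `L P`
and the eigenvalues, and a trace formula differentiates the eigenvalues once the `P^j` are
continuous, so the regularity of `L P` passes to `e^j` and `P^j` by bootstrapping.

Kato's maps carry `P^j_{k-1}` exactly onto `P^j_k`, hence the algebraic relations. A step of
`A_{k,T}` and a step of `L^P` differ by a term of order `1 / T`, off-diagonal with respect to the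
`P^j`. It is a commutator of `L^P` with an operator `Z` whose coefficients have the denominators
`e^i - e^j`, bounded below by the gap. Multiplying `A_{k,T}` by `1 + T⁻¹ Z_k` therefore leaves an
error of order `1 / T²` per step, and the `T` errors add up to `O(1 / T)`. Without the peripheral
projection, each change of subspace from one step to the next leaks `O(1 / T)`, and the leaks are
damped by powers of `ℓ`, which sum to `1 / (1 - ℓ)`.
-/

noncomputable section

namespace Adiabatic

open Filter Topology
open Finset.HasAntidiagonal (antidiagonal mem_antidiagonal)

theorem ringChoose_neg_half (n : ℕ) :
    Ring.choose (-1 / 2 : ℚ) n = (-1) ^ n * ((n.centralBinom : ℚ) / 4 ^ n) := by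
  induction n with
  | zero => simp
  | succ n ih =>
    have hsucc : ((n : ℚ) + 1) * Ring.choose (-1 / 2 : ℚ) (n + 1) =
        (-1 / 2 - n) * Ring.choose (-1 / 2 : ℚ) n := by
      simp only [Ring.choose_eq_smul, descPochhammer_succ_right, Polynomial.smeval_mul,
        Polynomial.smeval_sub, Polynomial.smeval_X, Polynomial.smeval_natCast, smul_eq_mul,
        Nat.factorial_succ]
      push_cast
      field_simp
      simp [mul_comm]
    have hcentral : ((n : ℚ) + 1) * (n + 1).centralBinom = 2 * (2 * n + 1) * n.centralBinom :=
      mod_cast n.succ_mul_centralBinom_succ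
    refine mul_left_cancel₀ n.cast_add_one_ne_zero ?_
    rw [hsucc, ih]
    linear_combination (1 / 4 * (-1) ^ n / 4 ^ n) * hcentral

theorem sum_antidiagonal_centralBinom_mul (n : ℕ) :
    ∑ p ∈ antidiagonal n, p.1.centralBinom * p.2.centralBinom = 4 ^ n := by
  have hone : Ring.choose (-1 : ℚ) n = (-1) ^ n := by
    simp [Ring.choose_neg, Ring.choose_natCast, Int.negOnePow, Units.smul_def]
  have hterm : ∀ p ∈ antidiagonal n,
      Ring.choose (-1 / 2 : ℚ) p.1 * Ring.choose (-1 / 2 : ℚ) p.2 =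
        (-1) ^ n / 4 ^ n * (p.1.centralBinom * p.2.centralBinom : ℕ) := fun p hp => by
    rw [ringChoose_neg_half, ringChoose_neg_half, ← mem_antidiagonal.1 hp, pow_add, pow_add]
    push_cast
    field_simp
  have hadd : (-1 : ℚ) ^ n =
      (-1) ^ n / 4 ^ n * (∑ p ∈ antidiagonal n, p.1.centralBinom * p.2.centralBinom : ℕ) :=
    calc (-1 : ℚ) ^ n = Ring.choose (-1 / 2 + -1 / 2 : ℚ) n := by rw [← hone]; norm_num
      _ = _ := by
        rw [Ring.add_choose_eq n (Commute.all _ _), Finset.sum_congr rfl hterm, ← Finset.mul_sum,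
          ← Nat.cast_sum]
  have hpow : (-1 : ℚ) ^ n ≠ 0 := pow_ne_zero n (by norm_num)
  field_simp at hadd
  exact_mod_cast hadd.symm

section InvSqrtSeries

variable {𝕜 R : Type*} [RCLike 𝕜] [NormedRing R] [NormedAlgebra 𝕜 R]

theorem centralBinom_div_four_pow_le_one (n : ℕ) : (n.centralBinom : ℝ) / 4 ^ n ≤ 1 := by
  rw [div_le_one (by positivity)]
  exact_mod_cast n.centralBinom_le_four_pow

theorem norm_centralBinom_smul_pow_le (h1 : ‖(1 : R)‖ ≤ 1) (B : R) (n : ℕ) :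
    ‖((n.centralBinom : 𝕜) / 4 ^ n) • B ^ n‖ ≤ ((n.centralBinom : ℝ) / 4 ^ n) * ‖B‖ ^ n := by
  have hB : ‖B ^ n‖ ≤ ‖B‖ ^ n := by
    rcases n.eq_zero_or_pos with rfl | hn
    · simpa using h1
    · exact norm_pow_le' B hn
  calc _ ≤ ‖(n.centralBinom : 𝕜) / 4 ^ n‖ * ‖B ^ n‖ := norm_smul_le _ _
    _ = ((n.centralBinom : ℝ) / 4 ^ n) * ‖B ^ n‖ := by simp
    _ ≤ _ := by gcongr

theorem summable_centralBinom_mul_pow {x : ℝ} (hx0 : 0 ≤ x) (hx : x < 1) :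
    Summable fun n : ℕ => ((n.centralBinom : ℝ) / 4 ^ n) * x ^ n :=
  .of_nonneg_of_le (fun n => by positivity)
    (fun n => mul_le_of_le_one_left (by positivity) (centralBinom_div_four_pow_le_one n))
    (summable_geometric_of_lt_one hx0 hx)

theorem summable_norm_centralBinom_smul_pow (h1 : ‖(1 : R)‖ ≤ 1) {B : R} (hB : ‖B‖ < 1) :
    Summable fun n : ℕ => ‖((n.centralBinom : 𝕜) / 4 ^ n) • B ^ n‖ :=
  .of_nonneg_of_le (fun _ => norm_nonneg _) (norm_centralBinom_smul_pow_le h1 B)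
    (summable_centralBinom_mul_pow (norm_nonneg B) hB)

theorem tsum_centralBinom_smul_pow_mul_self [CompleteSpace R] (h1 : ‖(1 : R)‖ ≤ 1) {B : R}
    (hB : ‖B‖ < 1) :
    (∑' n : ℕ, ((n.centralBinom : 𝕜) / 4 ^ n) • B ^ n) *
      (∑' n : ℕ, ((n.centralBinom : 𝕜) / 4 ^ n) • B ^ n) = ∑' n : ℕ, B ^ n := by
  have hs := summable_norm_centralBinom_smul_pow (𝕜 := 𝕜) h1 hB
  rw [tsum_mul_tsum_eq_tsum_sum_antidiagonal_of_summable_norm hs hs]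
  refine tsum_congr fun n => ?_
  calc ∑ p ∈ antidiagonal n, ((p.1.centralBinom : 𝕜) / 4 ^ p.1) • B ^ p.1 *
          ((p.2.centralBinom : 𝕜) / 4 ^ p.2) • B ^ p.2
      = ∑ p ∈ antidiagonal n,
          (((p.1.centralBinom * p.2.centralBinom : ℕ) : 𝕜) / 4 ^ n) • B ^ n := by
        refine Finset.sum_congr rfl fun p hp => ?_
        rw [smul_mul_smul_comm, ← pow_add, ← mem_antidiagonal.1 hp, div_mul_div_comm,
          ← pow_add 4, Nat.cast_mul]
    _ = B ^ n := by
        rw [← Finset.sum_smul, ← Finset.sum_div, ← Nat.cast_sum,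
          sum_antidiagonal_centralBinom_mul]
        simp

end InvSqrtSeries

theorem tsum_centralBinom_mul_pow {x : ℝ} (hx0 : 0 ≤ x) (hx : x < 1) :
    ∑' n : ℕ, ((n.centralBinom : ℝ) / 4 ^ n) * x ^ n = (1 - x) ^ (-(1 / 2) : ℝ) := by
  have hsq := tsum_centralBinom_smul_pow_mul_self (𝕜 := ℝ) (R := ℝ) (by simp)
    (by rwa [Real.norm_of_nonneg hx0])
  simp only [smul_eq_mul, tsum_geometric_of_lt_one hx0 hx] at hsq
  rw [Real.rpow_neg (by linarith), ← Real.sqrt_eq_rpow, ← Real.sqrt_inv, ← hsq,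
    Real.sqrt_mul_self (tsum_nonneg fun n => by positivity)]

section InvSqrtOneSub

variable {X : Type*} [NormedAddCommGroup X] [NormedSpace ℂ X]

theorem norm_invSqrtOneSub_le {B : X →L[ℂ] X} (hB : ‖B‖ < 1) :
    ‖invSqrtOneSub B‖ ≤ (1 - ‖B‖) ^ (-(1 / 2) : ℝ) := by
  rw [← tsum_centralBinom_mul_pow (norm_nonneg B) hB]
  exact tsum_of_norm_bounded (summable_centralBinom_mul_pow (norm_nonneg B) hB).hasSum
    (norm_centralBinom_smul_pow_le ContinuousLinearMap.norm_id_le B)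

variable [CompleteSpace X]

theorem summable_invSqrtOneSub {B : X →L[ℂ] X} (hB : ‖B‖ < 1) :
    Summable fun n : ℕ => ((n.centralBinom : ℂ) / 4 ^ n) • B ^ n :=
  (summable_norm_centralBinom_smul_pow ContinuousLinearMap.norm_id_le hB).of_norm

theorem norm_invSqrtOneSub_sub_one_le {B : X →L[ℂ] X} (hB : ‖B‖ < 1) :
    ‖invSqrtOneSub B - 1‖ ≤ ‖B‖ / (1 - ‖B‖) := by
  have htail : invSqrtOneSub B - 1 =
      ∑' n : ℕ, (((n + 1).centralBinom : ℂ) / 4 ^ (n + 1)) • B ^ (n + 1) := by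
    rw [invSqrtOneSub, (summable_invSqrtOneSub hB).tsum_eq_zero_add]
    simp
  rw [htail, div_eq_mul_inv]
  refine tsum_of_norm_bounded
    ((hasSum_geometric_of_lt_one (norm_nonneg B) hB).mul_left ‖B‖) fun n => ?_
  rw [← pow_succ']
  exact (norm_centralBinom_smul_pow_le ContinuousLinearMap.norm_id_le B (n + 1)).trans
    (mul_le_of_le_one_left (by positivity) (centralBinom_div_four_pow_le_one _))

theorem invSqrtOneSub_mul_self_mul {B : X →L[ℂ] X} (hB : ‖B‖ < 1) :
    invSqrtOneSub B * invSqrtOneSub B * (1 - B) = 1 := by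
  rw [invSqrtOneSub, tsum_centralBinom_smul_pow_mul_self ContinuousLinearMap.norm_id_le hB]
  exact geom_series_mul_neg B hB

theorem commute_invSqrtOneSub {B D : X →L[ℂ] X} (hB : ‖B‖ < 1) (h : Commute D B) :
    Commute D (invSqrtOneSub B) := by
  have hs := summable_invSqrtOneSub hB
  rw [commute_iff_eq, invSqrtOneSub, ← hs.tsum_mul_left, ← hs.tsum_mul_right]
  exact tsum_congr fun n => ((h.pow_right n).smul_right _).eq

end InvSqrtOneSub

section Resolvent

variable {R : Type*} [NormedRing R] [NormedAlgebra ℂ R]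

theorem resolvent_mul_of_mul_eq_smul {a e : R} {μ z : ℂ} (h : a * e = μ • e)
    (hz : z ∈ resolventSet ℂ a) (hzμ : z ≠ μ) : resolvent a z * e = (z - μ)⁻¹ • e := by
  have hmul : (algebraMap ℂ R z - a) * e = (z - μ) • e := by
    rw [sub_mul, h, Algebra.algebraMap_eq_smul_one, smul_one_mul, sub_smul]
  calc resolvent a z * e
      = resolvent a z * ((algebraMap ℂ R z - a) * (z - μ)⁻¹ • e) := by
        rw [mul_smul_comm, hmul, inv_smul_smul₀ (sub_ne_zero.2 hzμ)]
    _ = (z - μ)⁻¹ • e := Ring.inverse_mul_cancel_left _ _ hz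

theorem mul_resolvent_of_mul_eq_smul {a e : R} {μ z : ℂ} (h : e * a = μ • e)
    (hz : z ∈ resolventSet ℂ a) (hzμ : z ≠ μ) : e * resolvent a z = (z - μ)⁻¹ • e := by
  have hmul : e * (algebraMap ℂ R z - a) = (z - μ) • e := by
    rw [mul_sub, h, Algebra.algebraMap_eq_smul_one, mul_smul_one, sub_smul]
  calc e * resolvent a z
      = (z - μ)⁻¹ • e * (algebraMap ℂ R z - a) * resolvent a z := by
        rw [smul_mul_assoc, hmul, inv_smul_smul₀ (sub_ne_zero.2 hzμ)]
    _ = (z - μ)⁻¹ • e := Ring.mul_inverse_cancel_right _ _ hz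

theorem resolvent_eq_resolvent_add_smul_add {a e : R} {μ ν z : ℂ} (he : IsIdempotentElem e)
    (hae : a * e = μ • e) (hea : e * a = μ • e) (ha : z ∈ resolventSet ℂ a)
    (hb : z ∈ resolventSet ℂ (a + (ν - μ) • e)) (hzμ : z ≠ μ) (hzν : z ≠ ν) :
    resolvent a z =
      (z - μ)⁻¹ • e + (resolvent (a + (ν - μ) • e) z - (z - ν)⁻¹ • e) := by
  set b := a + (ν - μ) • e with hbdef
  have heb : e * b = ν • e := by
    rw [hbdef, mul_add, hea, mul_smul_comm, he.eq, ← add_smul, add_sub_cancel]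
  have hscalar : (μ - ν) * ((z - μ)⁻¹ * (z - ν)⁻¹) = (z - μ)⁻¹ - (z - ν)⁻¹ := by
    have := sub_ne_zero.2 hzμ
    have := sub_ne_zero.2 hzν
    field_simp
    ring
  have hsub : resolvent a z - resolvent b z = ((z - μ)⁻¹ - (z - ν)⁻¹) • e := calc
    resolvent a z - resolvent b z
        = (μ - ν) • (resolvent a z * e * (e * resolvent b z)) := by
          rw [spectrum.resolvent_sub_resolvent ha hb, hbdef, sub_add_cancel_left,
            ← neg_smul, neg_sub, mul_smul_comm, smul_mul_assoc, mul_assoc, mul_assoc,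
            ← mul_assoc e e, he.eq]
      _ = ((z - μ)⁻¹ - (z - ν)⁻¹) • e := by
          rw [resolvent_mul_of_mul_eq_smul hae ha hzμ, mul_resolvent_of_mul_eq_smul heb hb hzν,
            smul_mul_smul_comm, he.eq, smul_smul, hscalar]
  rw [sub_eq_iff_eq_add.1 hsub, sub_smul]
  abel

/-- Moving the eigenvalue `μ` of `a` to `ν`, outside the disc, leaves an element whose resolvent is
holomorphic on the disc. -/
theorem circleIntegral_resolvent_eq_smul [CompleteSpace R] {a e : R} {μ ν : ℂ} {r : ℝ} (hr : 0 < r)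
    (he : IsIdempotentElem e) (hae : a * e = μ • e) (hea : e * a = μ • e)
    (hν : ν ∉ Metric.closedBall μ r) (ha : Metric.sphere μ r ⊆ resolventSet ℂ a)
    (hb : Metric.closedBall μ r ⊆ resolventSet ℂ (a + (ν - μ) • e)) :
    ∮ z in C(μ, r), resolvent a z = (2 * Real.pi * Complex.I : ℂ) • e := by
  set b := a + (ν - μ) • e
  have hμ : ∀ z ∈ Metric.sphere μ r, z ≠ μ := fun z hz => Metric.ne_of_mem_sphere hz hr.ne'
  have hzν : ∀ z ∈ Metric.closedBall μ r, z ≠ ν := fun z hz h => hν (h ▸ hz)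
  have hsplit : ∀ z ∈ Metric.sphere μ r,
      resolvent a z = (z - μ)⁻¹ • e + (resolvent b z - (z - ν)⁻¹ • e) := fun z hz =>
    have hzb := Metric.sphere_subset_closedBall hz
    resolvent_eq_resolvent_add_smul_add he hae hea (ha hz) (hb hzb) (hμ z hz) (hzν z hzb)
  have hdiff : ∀ z ∈ Metric.closedBall μ r,
      DifferentiableAt ℂ (fun z => resolvent b z - (z - ν)⁻¹ • e) z := fun z hz =>
    (spectrum.hasDerivAt_resolvent_const_left (hb hz)).differentiableAt.sub
      (((differentiableAt_id.sub_const ν).inv (sub_ne_zero.2 (hzν z hz))).smul_const e)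
  have hcont : ContinuousOn (fun z => resolvent b z - (z - ν)⁻¹ • e) (Metric.closedBall μ r) :=
    fun z hz => (hdiff z hz).continuousAt.continuousWithinAt
  have hpole : ContinuousOn (fun z : ℂ => (z - μ)⁻¹ • e) (Metric.sphere μ r) :=
    ((continuousOn_id.sub continuousOn_const).inv₀ fun z hz => sub_ne_zero.2 (hμ z hz)).smul
      continuousOn_const
  rw [circleIntegral.integral_congr hr.le hsplit,
    circleIntegral.integral_add (hpole.circleIntegrable hr.le)
      ((hcont.mono Metric.sphere_subset_closedBall).circleIntegrable hr.le),
    Complex.circleIntegral_eq_zero_of_differentiable_on_off_countable hr.le countable_empty hcont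
      fun z hz => hdiff z (Metric.ball_subset_closedBall hz.1),
    circleIntegral.integral_smul_const, circleIntegral.integral_sub_center_inv μ hr.ne', add_zero]

end Resolvent

section LinearAlgebra

open Module Module.End

variable {K V : Type*} [Field K] [AddCommGroup V] [Module K V] {f : End K V} {μ : K}

theorem eigenspace_eq_maxGenEigenspace (h : finrank K (f.maxGenEigenspace μ) = 1) :
    f.eigenspace μ = f.maxGenEigenspace μ := by
  have : FiniteDimensional K (f.maxGenEigenspace μ) := FiniteDimensional.of_finrank_pos (by omega)
  have hne : f.maxGenEigenspace μ ≠ ⊥ := fun hbot => by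
    rw [hbot, finrank_bot] at h
    exact zero_ne_one h
  have heig : f.eigenspace μ ≠ ⊥ := HasUnifEigenvalue.lt one_pos hne
  have : FiniteDimensional K (f.eigenspace μ) :=
    Submodule.finiteDimensional_of_le eigenspace_le_maxGenEigenspace
  refine Submodule.eq_of_le_of_finrank_le eigenspace_le_maxGenEigenspace ?_
  exact h.trans_le (Submodule.one_le_finrank_iff.2 heig)

theorem isCompl_eigenspace_range [FiniteDimensional K V]
    (h : f.eigenspace μ = f.maxGenEigenspace μ) :
    IsCompl (f.eigenspace μ) (LinearMap.range (f - μ • 1)) := by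
  rw [eigenspace_def]
  refine (Submodule.isCompl_iff_disjoint _ _ ?_).2 (Submodule.disjoint_def.2 ?_)
  · rw [add_comm, LinearMap.finrank_range_add_finrank_ker]
  · rintro _ hx ⟨y, rfl⟩
    have hy : y ∈ f.maxGenEigenspace μ :=
      (mem_maxGenEigenspace f μ y).2 ⟨2, by rw [pow_two]; exact hx⟩
    rwa [← h, eigenspace_def] at hy

end LinearAlgebra

section SpectralProjector

variable {X : Type*} [NormedAddCommGroup X] [NormedSpace ℂ X] {A E : X →L[ℂ] X} {μ z : ℂ}

/-- `E` is the projection onto the eigenspace of `A` at `μ` along the range of `A - μ`, and has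
trace one: the spectral projector on a simple eigenvalue, described without contour integrals. -/
structure IsSimpleProj (A : X →L[ℂ] X) (μ : ℂ) (E : X →L[ℂ] X) : Prop where
  isIdempotentElem : IsIdempotentElem E
  range_eq : LinearMap.range (E : X →ₗ[ℂ] X) = Module.End.eigenspace (A : X →ₗ[ℂ] X) μ
  ker_eq : LinearMap.ker (E : X →ₗ[ℂ] X) = LinearMap.range ((A : X →ₗ[ℂ] X) - μ • 1)
  trace_eq : LinearMap.trace ℂ X (E : X →ₗ[ℂ] X) = 1

theorem IsSimpleProj.mul_left (h : IsSimpleProj A μ E) : A * E = μ • E := by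
  ext x
  have hx : E x ∈ LinearMap.range (E : X →ₗ[ℂ] X) := ⟨x, rfl⟩
  rw [h.range_eq] at hx
  exact Module.End.mem_eigenspace_iff.1 hx

theorem IsSimpleProj.mul_right (h : IsSimpleProj A μ E) : E * A = μ • E := by
  ext x
  have hx : A x - μ • x ∈ LinearMap.ker (E : X →ₗ[ℂ] X) := h.ker_eq ▸ ⟨x, rfl⟩
  simpa [sub_eq_zero] using hx

theorem IsSimpleProj.apply_eq_self (h : IsSimpleProj A μ E) {x : X} (hx : A x = μ • x) :
    E x = x := by
  have hmem : x ∈ Module.End.eigenspace (A : X →ₗ[ℂ] X) μ := Module.End.mem_eigenspace_iff.2 hx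
  obtain ⟨y, rfl⟩ := h.range_eq ▸ hmem
  exact congr($(h.isIdempotentElem.eq) y)

theorem isolatingRadius_lt_one (A : X →L[ℂ] X) (μ : ℂ) : isolatingRadius A μ < 1 := by
  have hmin : (min 1 (Metric.infEDist μ (spectrum ℂ A \ {μ}))).toReal ≤ 1 :=
    ENNReal.toReal_le_of_le_ofReal zero_le_one (by simp)
  unfold isolatingRadius
  linarith

variable [FiniteDimensional ℂ X]

theorem exists_isSimpleProj
    (h : Module.finrank ℂ (Module.End.maxGenEigenspace (A : X →ₗ[ℂ] X) μ) = 1) :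
    ∃ E, IsSimpleProj A μ E := by
  have heq := eigenspace_eq_maxGenEigenspace h
  have hc := isCompl_eigenspace_range heq
  refine ⟨LinearMap.toContinuousLinearMap (Submodule.projection _ _ hc), ?_,
    Submodule.range_projection hc, Submodule.ker_projection hc, ?_⟩
  · exact (Submodule.isIdempotentElem_projection hc).map
      (Module.End.toContinuousLinearMap X (𝕜 := ℂ))
  · have hdim : Module.finrank ℂ (Module.End.eigenspace (A : X →ₗ[ℂ] X) μ) = 1 := by rw [heq, h]
    have hproj : LinearMap.IsProj (Module.End.eigenspace (A : X →ₗ[ℂ] X) μ)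
        (Submodule.projection _ _ hc) :=
      ⟨Submodule.projection_apply_mem hc, fun _ => Submodule.projection_apply_of_mem_left hc⟩
    simpa only [hdim, Nat.cast_one] using! hproj.trace

theorem spectrum_coe (A : X →L[ℂ] X) : spectrum ℂ (A : X →ₗ[ℂ] X) = spectrum ℂ A :=
  AlgEquiv.spectrum_eq (Module.End.toContinuousLinearMap X (𝕜 := ℂ)).symm A

theorem mem_spectrum_iff_exists : z ∈ spectrum ℂ A ↔ ∃ x ≠ 0, A x = z • x := by
  simp only [← spectrum_coe, ← Module.End.hasEigenvalue_iff_mem_spectrum,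
    Module.End.hasEigenvalue_iff, Submodule.ne_bot_iff, Module.End.mem_eigenspace_iff,
    ContinuousLinearMap.coe_coe, and_comm, ne_eq]

theorem spectrum_finite (A : X →L[ℂ] X) : (spectrum ℂ A).Finite :=
  spectrum_coe A ▸ Module.End.finite_spectrum (A : X →ₗ[ℂ] X)

theorem isolatingRadius_pos (A : X →L[ℂ] X) (μ : ℂ) : 0 < isolatingRadius A μ := by
  have hcl : IsClosed (spectrum ℂ A \ {μ}) := ((spectrum_finite A).subset sdiff_subset).isClosed
  have hdist : 0 < Metric.infEDist μ (spectrum ℂ A \ {μ}) :=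
    pos_iff_ne_zero.2 fun h => ((Metric.mem_iff_infEDist_zero_of_closed hcl).2 h).2 rfl
  exact half_pos (ENNReal.toReal_pos (lt_min one_pos hdist).ne'
    (ne_top_of_le_ne_top ENNReal.one_ne_top (min_le_left _ _)))

theorem eq_of_mem_closedBall_isolatingRadius
    (hz : z ∈ Metric.closedBall μ (isolatingRadius A μ)) (hs : z ∈ spectrum ℂ A) : z = μ := by
  by_contra hne
  have hle : (min 1 (Metric.infEDist μ (spectrum ℂ A \ {μ}))).toReal ≤ dist z μ := by
    rw [dist_comm, dist_edist]
    exact ENNReal.toReal_mono (edist_ne_top _ _)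
      ((min_le_right _ _).trans (Metric.infEDist_le_edist_of_mem ⟨hs, hne⟩))
  have hdist : dist z μ ≤ isolatingRadius A μ := hz
  have hpos := isolatingRadius_pos A μ
  unfold isolatingRadius at hdist hpos
  linarith

theorem IsSimpleProj.closedBall_subset_resolventSet (h : IsSimpleProj A μ E) :
    Metric.closedBall μ (isolatingRadius A μ) ⊆ resolventSet ℂ (A + (2 : ℂ) • E) := by
  intro z hz
  by_contra hspec
  obtain ⟨x, hx0, hx⟩ := mem_spectrum_iff_exists.1 hspec
  have hz2 : z - (μ + 2) ≠ 0 := fun h0 => by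
    have hlt := (Metric.mem_closedBall.1 hz).trans_lt (isolatingRadius_lt_one A μ)
    rw [dist_eq_norm, sub_eq_iff_eq_add.1 h0] at hlt
    norm_num at hlt
  have hEx : E x = 0 := by
    have hE : E (A x) + (2 : ℂ) • E (E x) = z • E x := by simpa using congr(E $hx)
    have hmul : E (A x) = μ • E x := congr($(h.mul_right) x)
    have hidem : E (E x) = E x := congr($(h.isIdempotentElem.eq) x)
    rw [hmul, hidem, ← add_smul, ← sub_eq_zero, ← sub_smul] at hE
    exact (smul_eq_zero.1 hE).resolve_left fun h0 => hz2 (by rw [← neg_sub, h0, neg_zero])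
  have hAx : A x = z • x := by simpa [hEx] using hx
  obtain rfl := eq_of_mem_closedBall_isolatingRadius hz (mem_spectrum_iff_exists.2 ⟨x, hx0, hAx⟩)
  exact hx0 ((h.apply_eq_self hAx).symm.trans hEx)

theorem IsSimpleProj.spectralProj_eq (h : IsSimpleProj A μ E) : spectralProj A μ = E := by
  have hr := isolatingRadius_pos A μ
  have hsphere : Metric.sphere μ (isolatingRadius A μ) ⊆ resolventSet ℂ A := fun z hz => by
    by_contra hspec
    exact Metric.ne_of_mem_sphere hz hr.ne'
      (eq_of_mem_closedBall_isolatingRadius (Metric.sphere_subset_closedBall hz) hspec)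
  have hfar : μ + 2 ∉ Metric.closedBall μ (isolatingRadius A μ) := fun hmem => by
    have := (Metric.mem_closedBall.1 hmem).trans_lt (isolatingRadius_lt_one A μ)
    norm_num [dist_eq_norm] at this
  rw [spectralProj, circleIntegral_resolvent_eq_smul hr h.isIdempotentElem h.mul_left h.mul_right
    hfar hsphere (by simpa using h.closedBall_subset_resolventSet), smul_smul,
    inv_mul_cancel₀ Complex.two_pi_I_ne_zero, one_smul]

end SpectralProjector

section BirkhoffAverage

variable {𝕜 V : Type*} [RCLike 𝕜] [NormedAddCommGroup V] [NormedSpace 𝕜 V]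

theorem norm_birkhoffAverage_id_le {f : V →ₗ[𝕜] V} (hf : LipschitzWith 1 f) (n : ℕ) (x : V) :
    ‖birkhoffAverage 𝕜 f _root_.id n x‖ ≤ ‖x‖ := by
  have hiter (k : ℕ) : ‖f^[k] x‖ ≤ ‖x‖ := by
    simpa [iterate_map_zero] using (hf.iterate k).dist_le_mul x 0
  have hsum : ‖birkhoffSum f _root_.id n x‖ ≤ n * ‖x‖ := by
    simpa using! norm_sum_le_of_le (Finset.range n) fun k _ => hiter k
  rw [birkhoffAverage, norm_smul, norm_inv, RCLike.norm_natCast]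
  calc (n : ℝ)⁻¹ * ‖birkhoffSum f _root_.id n x‖ ≤ (n : ℝ)⁻¹ * (n * ‖x‖) := by gcongr
    _ = ((n : ℝ)⁻¹ * n) * ‖x‖ := (mul_assoc _ _ _).symm
    _ ≤ ‖x‖ := mul_le_of_le_one_left (norm_nonneg x) inv_mul_le_one

/-- By the mean ergodic theorem, `E` is the limit of the Birkhoff averages of `B`. -/
theorem norm_le_one_of_ker_eq_range_sub_one {B E : V →L[𝕜] V} (hB : ‖B‖ ≤ 1)
    (hBE : ∀ x, B (E x) = E x) (hE : ∀ x, B x = x → E x = x)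
    (hker : LinearMap.ker (E : V →ₗ[𝕜] V) = LinearMap.range ((B : V →ₗ[𝕜] V) - 1)) :
    ‖E‖ ≤ 1 := by
  have hlip : LipschitzWith 1 (B : V →ₗ[𝕜] V) :=
    ContinuousLinearMap.lipschitzWith_of_opNorm_le (by simpa using hB)
  have hlim (x : V) :
      Tendsto (birkhoffAverage 𝕜 (B : V →ₗ[𝕜] V) _root_.id · x) atTop (𝓝 (E x)) :=
    LinearMap.tendsto_birkhoffAverage_of_ker_subset_closure (B : V →ₗ[𝕜] V) hlip
      (E.codRestrict (LinearMap.eqLocus (B : V →ₗ[𝕜] V) 1) hBE)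
      (fun x => Subtype.ext (hE x x.2))
      (by
        rw [← hker]
        exact fun x hx => subset_closure congr(($hx : V))) x
  refine E.opNorm_le_bound zero_le_one fun x => ?_
  rw [one_mul]
  exact le_of_tendsto (hlim x).norm (Eventually.of_forall (norm_birkhoffAverage_id_le hlip · x))

end BirkhoffAverage

section IdempotentCalculus

variable {k R ι : Type*} [CommRing k] [Ring R] [Algebra k R] [Fintype ι] {p : ι → R}

theorem sum_smul_mul_sum_smul (hp : OrthogonalIdempotents p) (c d : ι → k) :
    (∑ i, c i • p i) * ∑ i, d i • p i = ∑ i, (c i * d i) • p i := by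
  classical
  simp only [Finset.sum_mul_sum, smul_mul_smul_comm, hp.mul_eq, smul_ite, smul_zero,
    Finset.sum_ite_eq, Finset.mem_univ, if_true]

theorem sum_smul_mul_proj (hp : OrthogonalIdempotents p) (c : ι → k) (i : ι) :
    (∑ j, c j • p j) * p i = c i • p i := by
  classical
  simp [Finset.sum_mul, hp.mul_eq, smul_ite]

theorem proj_mul_sum_smul (hp : OrthogonalIdempotents p) (c : ι → k) (i : ι) :
    p i * ∑ j, c j • p j = c i • p i := by
  classical
  simp [Finset.mul_sum, hp.mul_eq, smul_ite]

/-- The functional calculus of the elements `∑ i, c i • p i` for orthogonal idempotents `p i`: it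
sends `(c₀, c)` to the element with value `c i` on `p i` and `c₀` on the complement of all `p i`. -/
def idempotentCalculus (hp : OrthogonalIdempotents p) : k × (ι → k) →ₐ[k] R :=
  AlgHom.ofLinearMap
    ((LinearMap.toSpanSingleton k R (1 - ∑ i, p i)).coprod (Fintype.linearCombination k p))
    (by simp [Fintype.linearCombination_apply])
    (by
      have hidem : IsIdempotentElem (∑ i, p i) := hp.isIdempotentElem_sum
      have hcompl (c : ι → k) : (1 - ∑ i, p i) * ∑ i, c i • p i = 0 := by
        simpa [sub_mul, sub_eq_zero] using (sum_smul_mul_sum_smul hp (fun _ => 1) c).symm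
      have hcompl' (c : ι → k) : (∑ i, c i • p i) * (1 - ∑ i, p i) = 0 := by
        simpa [mul_sub, sub_eq_zero] using (sum_smul_mul_sum_smul hp c (fun _ => 1)).symm
      rintro ⟨c₀, c⟩ ⟨d₀, d⟩
      simp [Fintype.linearCombination_apply, add_mul, mul_add, hidem.one_sub.eq, hcompl, hcompl',
        sum_smul_mul_sum_smul hp, smul_smul, mul_comm d₀])

theorem idempotentCalculus_apply (hp : OrthogonalIdempotents p) (c₀ : k) (c : ι → k) :
    idempotentCalculus hp (c₀, c) = c₀ • (1 - ∑ i, p i) + ∑ i, c i • p i := rfl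

theorem idempotentCalculus_zero_left (hp : OrthogonalIdempotents p) (c : ι → k) :
    idempotentCalculus hp (0, c) = ∑ i, c i • p i := by
  rw [idempotentCalculus_apply, zero_smul, zero_add]

theorem sum_smul_pow (hp : OrthogonalIdempotents p) (c : ι → k) {n : ℕ} (hn : n ≠ 0) :
    (∑ i, c i • p i) ^ n = ∑ i, c i ^ n • p i := by
  rw [← idempotentCalculus_zero_left hp, ← map_pow, Prod.pow_mk, zero_pow hn,
    idempotentCalculus_zero_left]
  rfl

theorem pow_eq_sum_smul_add_pow {a : R} {e : ι → k} (hp : OrthogonalIdempotents p)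
    (hl : ∀ i, a * p i = e i • p i) (hr : ∀ i, p i * a = e i • p i) {n : ℕ} (hn : n ≠ 0) :
    a ^ n = (∑ i, e i ^ n • p i) + (a * (1 - ∑ i, p i)) ^ n := by
  have hidem : IsIdempotentElem (∑ i, p i) := hp.isIdempotentElem_sum
  have hmul : a * ∑ i, p i = ∑ i, e i • p i := by simp only [Finset.mul_sum, hl]
  have hcomm : Commute a (∑ i, p i) := by
    rw [Commute, SemiconjBy, hmul]
    simp only [Finset.sum_mul, hr]
  obtain ⟨m, rfl⟩ := Nat.exists_eq_succ_of_ne_zero hn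
  rw [← sum_smul_pow hp e hn, ← hmul, hcomm.mul_pow,
    ((Commute.one_right a).sub_right hcomm).mul_pow, hidem.pow_succ_eq,
    hidem.one_sub.pow_succ_eq, ← mul_add, add_sub_cancel, mul_one]

theorem idempotentCalculus_inv_mul_sub {k R ι : Type*} [Field k] [Ring R] [Algebra k R] [Fintype ι]
    {p : ι → R} (hp : OrthogonalIdempotents p) {z : k} {w : ι → k} (hz : z ≠ 0)
    (hw : ∀ i, z ≠ w i) :
    idempotentCalculus hp (z⁻¹, fun i => (z - w i)⁻¹) * (z • 1 - ∑ i, w i • p i) = 1 := by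
  have hsub : z • 1 - ∑ i, w i • p i = idempotentCalculus hp (z, fun i => z - w i) := by
    rw [← idempotentCalculus_zero_left hp, ← map_one (idempotentCalculus (k := k) hp), ← map_smul,
      ← map_sub]
    congr 1
    ext <;> simp
  rw [hsub, ← map_mul, ← map_one (idempotentCalculus (k := k) hp)]
  congr 1
  ext i
  · exact inv_mul_cancel₀ hz
  · exact inv_mul_cancel₀ (sub_ne_zero.2 (hw i))

end IdempotentCalculus

/-- Along a sequence of exponents for which all `e i ^ n` tend to `1`, the powers `a ^ n` tend to
`∑ i, p i`. -/
theorem norm_sum_le_one {R ι : Type*} [NormedRing R] [NormedAlgebra ℂ R] [Fintype ι] {a : R}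
    {e : ι → ℂ} {p : ι → R} (ha : ‖a‖ ≤ 1) (he : ∀ i, ‖e i‖ = 1) (hp : OrthogonalIdempotents p)
    (hl : ∀ i, a * p i = e i • p i) (hr : ∀ i, p i * a = e i • p i)
    (hQ : ‖a * (1 - ∑ i, p i)‖ < 1) : ‖∑ i, p i‖ ≤ 1 := by
  let u : ι → Circle := fun i => ⟨e i, mem_sphere_zero_iff_norm.2 (he i)⟩
  obtain ⟨U, hU, hu⟩ := mapClusterPt_iff_ultrafilter.1 (mapClusterPt_one_atTop_pow u)
  have hpow : ∀ᶠ n : ℕ in U, n ≠ 0 := hU (eventually_ne_atTop 0)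
  have hphase : Tendsto (fun n => ∑ i, e i ^ n • p i) U (𝓝 (∑ i, (1 : ℂ) • p i)) :=
    tendsto_finsetSum _ fun i _ =>
      ((continuous_subtype_val.tendsto (1 : Circle)).comp (tendsto_pi_nhds.1 hu i)).smul_const (p i)
  have hlim : Tendsto (fun n => a ^ n) U (𝓝 (∑ i, p i)) := by
    have hsum := hphase.add ((tendsto_pow_atTop_nhds_zero_of_norm_lt_one hQ).mono_left hU)
    simp only [one_smul, add_zero] at hsum
    exact hsum.congr' (hpow.mono fun n hn => (pow_eq_sum_smul_add_pow hp hl hr hn).symm)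
  refine le_of_tendsto hlim.norm (hpow.mono fun n hn => ?_)
  exact (norm_pow_le' a (Nat.pos_of_ne_zero hn)).trans (pow_le_one₀ (norm_nonneg a) ha)

section PeripheralFamily

variable {X ι : Type*} [NormedAddCommGroup X] [NormedSpace ℂ X] [Fintype ι] {A E F : X →L[ℂ] X}
  {μ ν : ℂ} {e : ι → ℂ}

theorem IsSimpleProj.mul_eq_zero (hE : IsSimpleProj A μ E) (hF : IsSimpleProj A ν F) (h : μ ≠ ν) :
    E * F = 0 := by
  have hsmul : μ • (E * F) = ν • (E * F) := by
    rw [← smul_mul_assoc, ← hE.mul_right, mul_assoc, hF.mul_left, mul_smul_comm]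
  by_contra hne
  exact h (smul_left_injective ℂ hne hsmul)

theorem IsSimpleProj.norm_le_one (h : IsSimpleProj A μ E) (hA : ‖A‖ ≤ 1) (hμ : ‖μ‖ = 1) :
    ‖E‖ ≤ 1 := by
  have hμ0 : μ ≠ 0 := norm_ne_zero_iff.1 (hμ.trans_ne one_ne_zero)
  have hAE (x : X) : A (E x) = μ • E x := congr($(h.mul_left) x)
  refine norm_le_one_of_ker_eq_range_sub_one (B := μ⁻¹ • A) ?_ (fun x => ?_) (fun x hx => ?_) ?_
  · rwa [norm_smul, norm_inv, hμ, inv_one, one_mul]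
  · rw [smul_apply, hAE, inv_smul_smul₀ hμ0]
  · exact h.apply_eq_self ((inv_smul_eq_iff₀ hμ0).1 hx)
  · have hscale : ((μ⁻¹ • A : X →L[ℂ] X) : X →ₗ[ℂ] X) - 1 = μ⁻¹ • ((A : X →ₗ[ℂ] X) - μ • 1) := by
      rw [smul_sub, inv_smul_smul₀ hμ0]
      rfl
    rw [h.ker_eq, hscale, LinearMap.range_smul _ _ (inv_ne_zero hμ0)]

/-- `p i` is the rank one spectral projector of the contraction `A` on the point `e i` of the unit
circle, and the sum of these projectors is a contraction. -/
structure IsPeripheralFamily (A : X →L[ℂ] X) (e : ι → ℂ) (p : ι → X →L[ℂ] X) : Prop where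
  norm_eig : ∀ i, ‖e i‖ = 1
  orthogonal : OrthogonalIdempotents p
  mul_left : ∀ i, A * p i = e i • p i
  mul_right : ∀ i, p i * A = e i • p i
  norm_le_one : ∀ i, ‖p i‖ ≤ 1
  trace_eq : ∀ i, LinearMap.trace ℂ X (p i : X →ₗ[ℂ] X) = 1
  norm_sum_le : ‖∑ i, p i‖ ≤ 1

theorem peripheralProj_eq_sum (hinj : Function.Injective e) (hr : range e = peripheralSpectrum A) :
    peripheralProj A = ∑ i, spectralProj A (e i) := by
  rw [peripheralProj, ← hr, finsum_mem_range hinj, finsum_eq_sum_of_fintype]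

theorem isPeripheralFamily_spectralProj [FiniteDimensional ℂ X] (hA : ‖A‖ ≤ 1)
    (hs : ∀ μ ∈ peripheralSpectrum A,
      Module.finrank ℂ (Module.End.maxGenEigenspace (A : X →ₗ[ℂ] X) μ) = 1)
    (hQ : ‖A * stableProj A‖ < 1) (hinj : Function.Injective e)
    (hr : range e = peripheralSpectrum A) :
    IsPeripheralFamily A e fun i => spectralProj A (e i) := by
  have hmem (i : ι) : e i ∈ peripheralSpectrum A := hr ▸ mem_range_self i
  have hnorm (i : ι) : ‖e i‖ = 1 := mem_sphere_zero_iff_norm.1 (hmem i).2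
  have hsimple (i : ι) : IsSimpleProj A (e i) (spectralProj A (e i)) := by
    obtain ⟨E, hE⟩ := exists_isSimpleProj (hs _ (hmem i))
    rwa [hE.spectralProj_eq]
  have horth : OrthogonalIdempotents fun i => spectralProj A (e i) :=
    ⟨fun i => (hsimple i).isIdempotentElem,
      fun i j hij => (hsimple i).mul_eq_zero (hsimple j) (hinj.ne hij)⟩
  rw [stableProj, peripheralProj_eq_sum hinj hr] at hQ
  exact
    { norm_eig := hnorm
      orthogonal := horth
      mul_left := fun i => (hsimple i).mul_left
      mul_right := fun i => (hsimple i).mul_right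
      norm_le_one := fun i => (hsimple i).norm_le_one hA (hnorm i)
      trace_eq := fun i => (hsimple i).trace_eq
      norm_sum_le := norm_sum_le_one hA hnorm horth (fun i => (hsimple i).mul_left)
        (fun i => (hsimple i).mul_right) hQ }

end PeripheralFamily

section Branches

variable {α : Type*} [MetricSpace α]

/-- The sets `S s`, `s ∈ [0,1]`, have uniformly separated points and vary uniformly continuously
with `s`. -/
structure IsSeparatedFamily (S : ℝ → Set α) (ε : ℝ) : Prop where
  pos : 0 < ε
  gap : ∀ s ∈ Icc (0 : ℝ) 1, ∀ z ∈ S s, ∀ w ∈ S s, z ≠ w → 2 * ε < dist z w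
  unif : ∀ δ > 0, ∃ η > 0, ∀ s ∈ Icc (0 : ℝ) 1, ∀ t ∈ Icc (0 : ℝ) 1, dist s t < η →
    ∀ z ∈ S s, ∃ w ∈ S t, dist z w < δ

/-- `f` is a continuous selection of the sets `S s` for `s ∈ J`. -/
structure IsBranch (S : ℝ → Set α) (J : Set ℝ) (f : ℝ → α) : Prop where
  continuousOn : ContinuousOn f J
  mem : ∀ s ∈ J, f s ∈ S s

theorem continuousOn_ite_le {f g : ℝ → α} {a b c : ℝ} (hf : ContinuousOn f (Icc a b))
    (hg : ContinuousOn g (Icc b c)) (h : f b = g b) :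
    ContinuousOn (fun s => if s ≤ b then f s else g s) (Icc a c) := by
  refine ContinuousOn.mono (.union_of_isClosed (hf.congr fun s hs => if_pos hs.2)
    (hg.congr fun s hs => ?_) isClosed_Icc isClosed_Icc) Icc_subset_Icc_union_Icc
  rcases hs.1.eq_or_lt with rfl | hlt
  · rw [if_pos le_rfl, h]
  · rw [if_neg hlt.not_ge]

namespace IsSeparatedFamily

variable {S : ℝ → Set α} {ε : ℝ} {s : ℝ} {f g : ℝ → α}

theorem eq_of_dist_le (h : IsSeparatedFamily S ε) (hs : s ∈ Icc (0 : ℝ) 1) {z w : α}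
    (hz : z ∈ S s) (hw : w ∈ S s) (hzw : dist z w ≤ 2 * ε) : z = w := by
  by_contra hne
  exact (h.gap s hs z hz w hw hne).not_ge hzw

theorem eq_of_dist_lt (h : IsSeparatedFamily S ε) (hs : s ∈ Icc (0 : ℝ) 1) {x z w : α}
    (hz : z ∈ S s) (hw : w ∈ S s) (hxz : dist x z < ε) (hxw : dist x w < ε) : z = w := by
  refine h.eq_of_dist_le hs hz hw ?_
  linarith [dist_triangle_left z w x]

theorem isBranch_of_dist_lt (h : IsSeparatedFamily S ε) {J : Set ℝ} (hJ : J ⊆ Icc 0 1) {z : α}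
    (hg : ∀ s ∈ J, g s ∈ S s) (hz : ∀ s ∈ J, dist z (g s) < ε) : IsBranch S J g := by
  refine ⟨Metric.continuousOn_iff.2 fun s hs δ hδ => ?_, hg⟩
  obtain ⟨η, hη, hunif⟩ := h.unif (min δ (ε - dist z (g s))) (lt_min hδ (sub_pos.2 (hz s hs)))
  refine ⟨η, hη, fun t ht hts => ?_⟩
  obtain ⟨w, hw, hgw⟩ := hunif s (hJ hs) t (hJ ht) (by rwa [dist_comm]) _ (hg s hs)
  have hzw : dist z w < ε := by
    linarith [dist_triangle z (g s) w, hgw.trans_le (min_le_right _ _)]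
  rw [h.eq_of_dist_lt (hJ ht) (hg t ht) hw (hz t ht) hzw, dist_comm]
  exact hgw.trans_le (min_le_left _ _)

theorem exists_local_branch (h : IsSeparatedFamily S ε) :
    ∃ η > 0, ∀ a b : ℝ, 0 ≤ a → a ≤ b → b ≤ 1 → b - a < η → ∀ z ∈ S a,
      ∃ g, IsBranch S (Icc a b) g ∧ g a = z := by
  obtain ⟨η, hη, hunif⟩ := h.unif ε h.pos
  refine ⟨η, hη, fun a b ha hab hb hbη z hz => ?_⟩
  have hJ : Icc a b ⊆ Icc 0 1 := Icc_subset_Icc ha hb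
  have haJ : a ∈ Icc a b := left_mem_Icc.2 hab
  have hnear : ∀ s ∈ Icc a b, ∃ w ∈ S s, dist z w < ε := fun s hs =>
    hunif a (hJ haJ) s (hJ hs) (by rw [dist_comm, Real.dist_eq, abs_lt]; grind) z hz
  have : Nonempty α := ⟨z⟩
  choose! g hgS hgε using hnear
  exact ⟨g, h.isBranch_of_dist_lt hJ hgS hgε,
    h.eq_of_dist_lt (hJ haJ) (hgS a haJ) hz (hgε a haJ) (by rw [dist_self]; exact h.pos)⟩

theorem exists_branch (h : IsSeparatedFamily S ε) {z : α} (hz : z ∈ S 0) :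
    ∃ f, IsBranch S (Icc 0 1) f ∧ f 0 = z := by
  obtain ⟨η, hη, hlocal⟩ := h.exists_local_branch
  have hstep (k : ℕ) : ∃ f, IsBranch S (Icc 0 (min (k * (η / 2)) 1)) f ∧ f 0 = z := by
    induction k with
    | zero =>
      refine ⟨fun _ => z, ⟨continuousOn_const, fun s hs => ?_⟩, rfl⟩
      obtain rfl : s = 0 := by simpa using hs
      exact hz
    | succ k ih =>
      obtain ⟨f, hf, hf0⟩ := ih
      set a := min (k * (η / 2)) 1 with ha
      set b := min ((k + 1 : ℕ) * (η / 2)) 1 with hb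
      have ha0 : 0 ≤ a := by positivity
      have hab : a ≤ b := by rw [ha, hb]; gcongr; simp
      have hba : b - a < η := by grind
      obtain ⟨g, hg, hga⟩ :=
        hlocal a b ha0 hab (min_le_right _ _) hba (f a) (hf.mem a (right_mem_Icc.2 ha0))
      refine ⟨fun s => if s ≤ a then f s else g s,
        ⟨continuousOn_ite_le hf.continuousOn hg.continuousOn hga.symm, fun s hs => ?_⟩, ?_⟩
      · split_ifs with hsa
        · exact hf.mem s ⟨hs.1, hsa⟩
        · exact hg.mem s ⟨(not_le.1 hsa).le, hs.2⟩
      · exact (if_pos ha0).trans hf0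
  obtain ⟨k, hk⟩ := exists_nat_ge (1 / (η / 2))
  rw [div_le_iff₀ (half_pos hη)] at hk
  simpa only [min_eq_right hk] using hstep k

theorem branch_ne (h : IsSeparatedFamily S ε) (hf : IsBranch S (Icc 0 1) f)
    (hg : IsBranch S (Icc 0 1) g) (h0 : f 0 ≠ g 0) (hs : s ∈ Icc (0 : ℝ) 1) : f s ≠ g s := by
  intro heq
  have hpos := h.pos
  have hsub : Icc 0 s ⊆ Icc (0 : ℝ) 1 := Icc_subset_Icc_right hs.2
  have hzero : (0 : ℝ) ∈ Icc (0 : ℝ) 1 := unitInterval.zero_mem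
  have hgap := h.gap 0 hzero _ (hf.mem 0 hzero) _ (hg.mem 0 hzero) h0
  have hcont : ContinuousOn (fun t => dist (f t) (g t)) (Icc 0 s) :=
    continuous_dist.comp_continuousOn
      ((hf.continuousOn.mono hsub).prodMk (hg.continuousOn.mono hsub))
  obtain ⟨t, ht, hte : dist (f t) (g t) = ε⟩ := intermediate_value_Icc' hs.1 hcont
    (show ε ∈ Icc (dist (f s) (g s)) (dist (f 0) (g 0)) by
      rw [heq, dist_self]; constructor <;> linarith)
  have hft : f t = g t :=
    h.eq_of_dist_le (hsub ht) (hf.mem t (hsub ht)) (hg.mem t (hsub ht)) (by linarith)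
  rw [hft, dist_self] at hte
  exact hpos.ne hte

theorem ncard_eq (h : IsSeparatedFamily S ε) (hfin : ∀ s ∈ Icc (0 : ℝ) 1, (S s).Finite)
    {s t : ℝ} (hs : s ∈ Icc (0 : ℝ) 1) (ht : t ∈ Icc (0 : ℝ) 1) :
    (S s).ncard = (S t).ncard := by
  obtain ⟨η, hη, hunif⟩ := h.unif ε h.pos
  have hle : ∀ s ∈ Icc (0 : ℝ) 1, ∀ t ∈ Icc (0 : ℝ) 1, dist s t < η →
      (S s).ncard ≤ (S t).ncard := fun s hs t ht hst => by
    choose! φ hφS hφε using hunif s hs t ht hst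
    refine ncard_le_ncard_of_injOn φ hφS (fun z hz w hw hzw => ?_) (hfin t ht)
    refine h.eq_of_dist_lt hs (x := φ z) hz hw ?_ ?_
    · rw [dist_comm]
      exact hφε z hz
    · rw [hzw, dist_comm]
      exact hφε w hw
  refine isPreconnected_Icc.constant (f := fun s => (S s).ncard) (fun s hs => ?_) hs ht
  refine tendsto_const_nhds.congr' ?_
  filter_upwards [self_mem_nhdsWithin, mem_nhdsWithin_of_mem_nhds (Metric.ball_mem_nhds s hη)]
    with t ht hts
  exact le_antisymm (hle s hs t ht (by rwa [dist_comm])) (hle t ht s hs hts)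

theorem exists_labelling (h : IsSeparatedFamily S ε)
    (hfin : ∀ s ∈ Icc (0 : ℝ) 1, (S s).Finite) {N : ℕ} (hN : (S 0).ncard = N) :
    ∃ e : Fin N → ℝ → α, (∀ j, ContinuousOn (e j) (Icc 0 1)) ∧
      (∀ s ∈ Icc (0 : ℝ) 1, Function.Injective fun j => e j s) ∧
      ∀ s ∈ Icc (0 : ℝ) 1, range (fun j => e j s) = S s := by
  have hzero : (0 : ℝ) ∈ Icc (0 : ℝ) 1 := unitInterval.zero_mem
  have := (hfin 0 hzero).to_subtype
  let φ : S 0 ≃ Fin N := Finite.equivFinOfCardEq hN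
  choose f hf hf0 using fun j => h.exists_branch (φ.symm j).2
  have hinj : ∀ s ∈ Icc (0 : ℝ) 1, Function.Injective fun j => f j s := fun s hs i j hij => by
    by_contra hne
    refine h.branch_ne (hf i) (hf j) ?_ hs hij
    rw [hf0, hf0]
    exact fun heq => hne (φ.symm.injective (Subtype.ext heq))
  refine ⟨f, fun j => (hf j).continuousOn, hinj, fun s hs => ?_⟩
  refine eq_of_subset_of_ncard_le (range_subset_iff.2 fun j => (hf j).mem s hs) ?_ (hfin s hs)
  rw [← image_univ, ncard_image_of_injective _ (hinj s hs), ncard_univ, Nat.card_fin,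
    h.ncard_eq hfin hs hzero, hN]

end IsSeparatedFamily

end Branches

section Trace

variable {X : Type*} [NormedAddCommGroup X] [NormedSpace ℂ X] [FiniteDimensional ℂ X]

/-- The trace as a continuous linear functional on the bounded operators of `X`. -/
def traceCLM (X : Type*) [NormedAddCommGroup X] [NormedSpace ℂ X] [FiniteDimensional ℂ X] :
    (X →L[ℂ] X) →L[ℂ] ℂ :=
  LinearMap.toContinuousLinearMap (LinearMap.trace ℂ X ∘ₗ ContinuousLinearMap.coeLM ℂ)

theorem traceCLM_apply (A : X →L[ℂ] X) :
    traceCLM X A = LinearMap.trace ℂ X (A : X →ₗ[ℂ] X) := rfl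

end Trace

namespace IsPeripheralFamily

variable {X ι κ : Type*} [NormedAddCommGroup X] [NormedSpace ℂ X] [Fintype ι] [Fintype κ]
  {A B : X →L[ℂ] X} {e : ι → ℂ} {w : κ → ℂ} {p : ι → X →L[ℂ] X} {q : κ → X →L[ℂ] X} {z : ℂ} {δ : ℝ}

theorem eig_ne_zero (h : IsPeripheralFamily A e p) (i : ι) : e i ≠ 0 :=
  norm_ne_zero_iff.1 ((h.norm_eig i).trans_ne one_ne_zero)

theorem proj_ne_zero (h : IsPeripheralFamily A e p) (i : ι) : p i ≠ 0 := fun h0 => by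
  simpa [h0] using h.trace_eq i

theorem mul_sum_proj (h : IsPeripheralFamily A e p) : A * ∑ i, p i = ∑ i, e i • p i := by
  simp only [Finset.mul_sum, h.mul_left]

variable [FiniteDimensional ℂ X]

theorem card_le_norm_traceCLM (h : IsPeripheralFamily A e p) :
    (Fintype.card ι : ℝ) ≤ ‖traceCLM X‖ := by
  have htrace : traceCLM X (∑ i, p i) = Fintype.card ι := by
    simp [traceCLM_apply, h.trace_eq]
  calc (Fintype.card ι : ℝ) = ‖traceCLM X (∑ i, p i)‖ := by rw [htrace, Complex.norm_natCast]
    _ ≤ ‖traceCLM X‖ * ‖∑ i, p i‖ := (traceCLM X).le_opNorm _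
    _ ≤ ‖traceCLM X‖ := mul_le_of_le_one_right (norm_nonneg (traceCLM X)) h.norm_sum_le

theorem norm_idempotentCalculus_inv_le (h : IsPeripheralFamily A e p) (hz : ‖z‖ = 1) (hδ : 0 < δ)
    (hdist : ∀ i, δ ≤ dist z (e i)) :
    ‖idempotentCalculus h.orthogonal (z⁻¹, fun i => (z - e i)⁻¹)‖ ≤ ‖traceCLM X‖ / δ + 2 := by
  have hterm : ∀ i ∈ Finset.univ, ‖(z - e i)⁻¹ • p i‖ ≤ δ⁻¹ := fun i _ => by
    rw [norm_smul, norm_inv, ← dist_eq_norm, ← mul_one δ⁻¹]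
    gcongr
    · exact hdist i
    · exact h.norm_le_one i
  have hsum : ‖∑ i, (z - e i)⁻¹ • p i‖ ≤ ‖traceCLM X‖ / δ := calc
    ‖∑ i, (z - e i)⁻¹ • p i‖ ≤ Fintype.card ι * δ⁻¹ := by
      simpa using norm_sum_le_of_le Finset.univ hterm
    _ ≤ ‖traceCLM X‖ / δ := by
      rw [div_eq_mul_inv]
      gcongr
      exact h.card_le_norm_traceCLM
  have hcompl : ‖z⁻¹ • (1 - ∑ i, p i)‖ ≤ 2 := by
    rw [norm_smul, norm_inv, hz, inv_one, one_mul, ← one_add_one_eq_two]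
    exact norm_sub_le_of_le ContinuousLinearMap.norm_id_le h.norm_sum_le
  rw [idempotentCalculus_apply, add_comm]
  exact norm_add_le_of_le hsum hcompl

/-- On the range of `p i`, the difference of `A P` and `B Q` acts as `e i - B Q`, which is
invertible when `e i` keeps away from the spectrum of `B Q`. -/
theorem one_le_mul_norm_sub_of_le_dist (hA : IsPeripheralFamily A e p)
    (hB : IsPeripheralFamily B w q) (i : ι) (hδ : 0 < δ) (hdist : ∀ j, δ ≤ dist (e i) (w j)) :
    1 ≤ (‖traceCLM X‖ / δ + 2) * ‖A * ∑ i, p i - B * ∑ j, q j‖ := by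
  set R := idempotentCalculus hB.orthogonal ((e i)⁻¹, fun j => (e i - w j)⁻¹)
  have hR : R * (e i • 1 - B * ∑ j, q j) = 1 := by
    rw [hB.mul_sum_proj]
    exact idempotentCalculus_inv_mul_sub hB.orthogonal (hA.eig_ne_zero i)
      fun j => dist_pos.1 (hδ.trans_le (hdist j))
  have hdiff : (A * ∑ i, p i - B * ∑ j, q j) * p i = (e i • 1 - B * ∑ j, q j) * p i := by
    rw [sub_mul, hA.mul_sum_proj, sum_smul_mul_proj hA.orthogonal, sub_mul, smul_one_mul]
  have hproj : p i = R * (A * ∑ i, p i - B * ∑ j, q j) * p i := by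
    rw [mul_assoc, hdiff, ← mul_assoc, hR, one_mul]
  have hpos : 0 < ‖p i‖ := norm_pos_iff.2 (hA.proj_ne_zero i)
  refine le_of_mul_le_mul_right ?_ hpos
  calc 1 * ‖p i‖ = ‖R * (A * ∑ i, p i - B * ∑ j, q j) * p i‖ := by rw [one_mul, ← hproj]
    _ ≤ ‖R‖ * ‖A * ∑ i, p i - B * ∑ j, q j‖ * ‖p i‖ := norm_mul₃_le
    _ ≤ _ := by
      gcongr
      exact hB.norm_idempotentCalculus_inv_le (hA.norm_eig i) hδ hdist

end IsPeripheralFamily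

section Labelling

variable {X : Type*} [NormedAddCommGroup X] [NormedSpace ℂ X] {L : ℝ → X →L[ℂ] X} {ε ℓ s : ℝ}

theorem Hypotheses.norm_mul_stableProj_le (h : Hypotheses L ε ℓ) (hs : s ∈ Icc (0 : ℝ) 1) :
    ‖L s * stableProj (L s)‖ ≤ ℓ :=
  h.isLUB.1 ⟨s, hs, rfl⟩

variable [FiniteDimensional ℂ X]

theorem peripheralSpectrum_finite (A : X →L[ℂ] X) :
    (peripheralSpectrum A).Finite :=
  (spectrum_finite A).subset inter_subset_left

theorem Hypotheses.isPeripheralFamily (h : Hypotheses L ε ℓ) (hs : s ∈ Icc (0 : ℝ) 1) {ι : Type*}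
    [Fintype ι] {e : ι → ℂ} (hinj : Function.Injective e)
    (hr : range e = peripheralSpectrum (L s)) :
    IsPeripheralFamily (L s) e fun i => spectralProj (L s) (e i) :=
  isPeripheralFamily_spectralProj (h.contraction s hs) (h.simple s hs)
    ((h.norm_mul_stableProj_le hs).trans_lt h.lt_one) hinj hr

theorem Hypotheses.isSeparatedFamily (h : Hypotheses L ε ℓ) :
    IsSeparatedFamily (fun s => peripheralSpectrum (L s)) ε where
  pos := h.gap_pos
  gap s hs z hz w hw hzw := by
    rw [dist_eq_norm]
    exact h.gap s hs z hz w hw hzw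
  unif δ hδ := by
    have hK : 0 < ‖traceCLM X‖ / δ + 2 := by positivity
    obtain ⟨η, hη, hunif⟩ := Metric.uniformContinuousOn_iff.1
      (isCompact_Icc.uniformContinuousOn_of_continuous h.contDiffOn.continuousOn)
      (‖traceCLM X‖ / δ + 2)⁻¹ (inv_pos.2 hK)
    refine ⟨η, hη, fun s hs t ht hst z hz => ?_⟩
    by_contra! hfar
    have := (peripheralSpectrum_finite (L s)).fintype
    have := (peripheralSpectrum_finite (L t)).fintype
    have hone := (h.isPeripheralFamily hs Subtype.val_injective
      Subtype.range_coe).one_le_mul_norm_sub_of_le_dist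
      (h.isPeripheralFamily ht Subtype.val_injective Subtype.range_coe) ⟨z, hz⟩ hδ
      fun w => hfar w w.2
    rw [← peripheralProj_eq_sum Subtype.val_injective Subtype.range_coe,
      ← peripheralProj_eq_sum Subtype.val_injective Subtype.range_coe] at hone
    have hclose := hunif s hs t ht hst
    rw [dist_eq_norm, ← one_div, lt_div_iff₀' hK] at hclose
    exact hclose.not_ge hone

theorem Hypotheses.ncard_peripheralSpectrum (h : Hypotheses L ε ℓ) (hs : s ∈ Icc (0 : ℝ) 1) :
    (peripheralSpectrum (L s)).ncard = maxCount L := by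
  have hconst (t : Icc (0 : ℝ) 1) :
      (peripheralSpectrum (L t)).ncard = (peripheralSpectrum (L s)).ncard :=
    h.isSeparatedFamily.ncard_eq (fun s _ => peripheralSpectrum_finite (L s)) t.2 hs
  have : Nonempty (Icc (0 : ℝ) 1) := ⟨⟨s, hs⟩⟩
  simp only [maxCount, hconst, ciSup_const]

theorem Hypotheses.exists_isLabelling (h : Hypotheses L ε ℓ) :
    ∃ e : Fin (maxCount L) → ℝ → ℂ, IsLabelling L e := by
  obtain ⟨e, hcont, hinj, hrange⟩ := h.isSeparatedFamily.exists_labelling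
    (fun s _ => peripheralSpectrum_finite (L s))
    (h.ncard_peripheralSpectrum unitInterval.zero_mem)
  exact ⟨e, hcont, hinj, hrange⟩

end Labelling

section LagrangeInterpolation

variable {k R ι : Type*} [Field k] [Ring R] [Algebra k R] [Fintype ι] [DecidableEq ι] {p : ι → R}
  {e : ι → k}

theorem eq_smul_list_prod (hp : OrthogonalIdempotents p) (hinj : Function.Injective e) {j : ι}
    (hj : e j ≠ 0) :
    p j = (e j)⁻¹ • ((((Finset.univ.erase j).toList.map fun i =>
      (e j - e i)⁻¹ • ((∑ l, e l • p l) - e i • 1)).prod) * ∑ l, e l • p l) := by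
  let φ := idempotentCalculus (k := k) hp
  have hlagrange : ((0, Pi.single j 1) : k × (ι → k)) = (e j)⁻¹ •
      (((Finset.univ.erase j).toList.map fun i =>
        (e j - e i)⁻¹ • ((0, e) - e i • (1 : k × (ι → k)))).prod * (0, e)) := by
    rw [Finset.prod_map_toList]
    refine Prod.ext (by simp) (funext fun l => ?_)
    rcases eq_or_ne l j with rfl | hl
    · have hone : ∏ i ∈ Finset.univ.erase l, (e l - e i)⁻¹ * (e l - e i) = 1 :=
        Finset.prod_eq_one fun i hi =>
          inv_mul_cancel₀ (sub_ne_zero.2 (hinj.ne (Finset.ne_of_mem_erase hi).symm))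
      simp [Prod.snd_prod, Finset.prod_apply, hone, hj]
    · have hzero : ∏ i ∈ Finset.univ.erase j, (e j - e i)⁻¹ * (e l - e i) = 0 :=
        Finset.prod_eq_zero (Finset.mem_erase.2 ⟨hl, Finset.mem_univ l⟩) (by simp)
      simp [Prod.snd_prod, Finset.prod_apply, hzero, hl]
  have hφe : φ (0, e) = ∑ l, e l • p l := idempotentCalculus_zero_left hp e
  calc p j = φ (0, Pi.single j 1) := by
        simp [φ, idempotentCalculus_zero_left, Pi.single_apply, ite_smul]
    _ = _ := by
        rw [hlagrange, map_smul, map_mul, map_list_prod, List.map_map, hφe]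
        simp only [Function.comp_def, map_smul, map_sub, map_one, hφe]

end LagrangeInterpolation

section Calculus

theorem contDiffOn_list_prod {𝕜 E ι R : Type*} [NontriviallyNormedField 𝕜] [NormedAddCommGroup E]
    [NormedSpace 𝕜 E] [NormedRing R] [NormedAlgebra 𝕜 R] {n : WithTop ℕ∞} {f : ι → E → R}
    {u : Set E} {l : List ι} (hf : ∀ i ∈ l, ContDiffOn 𝕜 n (f i) u) :
    ContDiffOn 𝕜 n (fun x => (l.map fun i => f i x).prod) u := by
  induction l with
  | nil => simpa using contDiffOn_const
  | cons a l ih =>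
    simp only [List.map_cons, List.prod_cons]
    exact (hf a List.mem_cons_self).mul (ih fun i hi => hf i (List.mem_cons_of_mem a hi))

section Eigenvalue

variable {R : Type*} [NormedRing R] [NormedAlgebra ℂ R] {τ : R →L[ℂ] ℂ} {M p : ℝ → R}
  {e : ℝ → ℂ} {M' : R} {J : Set ℝ} {s : ℝ}

theorem map_mul_slope_mul_eq {t : ℝ} (hl : p s * M s = e s • p s) (hr : M t * p t = e t • p t) :
    τ (p s * slope M s t * p t) = slope e s t * τ (p s * p t) := by
  have hdiff : p s * (M t - M s) * p t = (e t - e s) • (p s * p t) := by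
    rw [mul_sub, sub_mul, mul_assoc, hr, hl, mul_smul_comm, smul_mul_assoc, sub_smul]
  rw [slope_def_module, slope_def_module, mul_smul_comm, smul_mul_assoc, hdiff,
    ← Complex.coe_smul, ← Complex.coe_smul, map_smul, map_smul, smul_eq_mul, smul_eq_mul,
    smul_eq_mul, mul_assoc]

/-- First order perturbation theory with only continuous eigenprojections: divide
`τ (p s * (M t - M s) * p t) = (e t - e s) * τ (p s * p t)` by `t - s`. -/
theorem hasDerivWithinAt_eigenvalue (hp : ContinuousWithinAt p J s)
    (hM : HasDerivWithinAt M M' J s) (hτ : τ (p s * p s) = 1) (hl : p s * M s = e s • p s)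
    (hr : ∀ t ∈ J, M t * p t = e t • p t) :
    HasDerivWithinAt e (τ (p s * M' * p s)) J s := by
  rw [hasDerivWithinAt_iff_tendsto_slope] at hM ⊢
  have hps : Tendsto p (𝓝[J \ {s}] s) (𝓝 (p s)) :=
    hp.mono_left (nhdsWithin_mono _ sdiff_subset)
  have hden : Tendsto (fun t => τ (p s * p t)) (𝓝[J \ {s}] s) (𝓝 1) :=
    hτ ▸ (τ.continuous.tendsto _).comp (hps.const_mul _)
  have hnum : Tendsto (fun t => τ (p s * slope M s t * p t)) (𝓝[J \ {s}] s)
      (𝓝 (τ (p s * M' * p s))) :=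
    (τ.continuous.tendsto _).comp ((hM.const_mul _).mul hps)
  have hquot := hnum.div hden one_ne_zero
  rw [div_one] at hquot
  refine hquot.congr' ?_
  filter_upwards [hden.eventually_ne one_ne_zero, self_mem_nhdsWithin] with t ht htJ
  rw [Pi.div_apply, map_mul_slope_mul_eq hl (hr t htJ.1), mul_div_cancel_right₀ _ ht]

end Eigenvalue

theorem mul_derivWithin_eq_neg {R : Type*} [NormedRing R] [NormedAlgebra ℝ R] {f g : ℝ → R}
    {J : Set ℝ} {s : ℝ} (hf : DifferentiableWithinAt ℝ f J s)
    (hg : DifferentiableWithinAt ℝ g J s) (h : ∀ t ∈ J, f t * g t = 0) (hs : s ∈ J)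
    (hJ : UniqueDiffWithinAt ℝ J s) :
    f s * derivWithin g J s = -(derivWithin f J s * g s) := by
  have hzero : HasDerivWithinAt (f * g) 0 J s :=
    (hasDerivWithinAt_const s J 0).congr h (h s hs)
  exact eq_neg_of_add_eq_zero_right
    (hJ.eq_deriv _ (hf.hasDerivWithinAt.mul hg.hasDerivWithinAt) hzero)

variable {F : Type*} [NormedAddCommGroup F] [NormedSpace ℝ F]

theorem exists_norm_iteratedDerivWithin_le {ι : Type*} [Finite ι] {K : Set ℝ} {n : ℕ}
    {f : ι → ℝ → F} (hK : IsCompact K) (hu : UniqueDiffOn ℝ K)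
    (hf : ∀ i, ContDiffOn ℝ n (f i) K) :
    ∃ c : ℝ, ∀ s ∈ K, ∀ i, ∀ m ≤ n, ‖iteratedDerivWithin m (f i) K s‖ ≤ c := by
  have hbound (x : ι × Iic n) : ∃ c : ℝ, ∀ s ∈ K, ‖iteratedDerivWithin x.2 (f x.1) K s‖ ≤ c :=
    hK.exists_bound_of_continuousOn
      ((hf x.1).continuousOn_iteratedDerivWithin (by exact_mod_cast x.2.2) hu)
  choose c hc using hbound
  obtain ⟨C, hC⟩ := (finite_range c).bddAbove
  exact ⟨C, fun s hs i m hm => (hc (i, ⟨m, hm⟩) s hs).trans (hC ⟨_, rfl⟩)⟩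

section Taylor

variable {f : ℝ → F} {c s t : ℝ} {J : Set ℝ}

theorem norm_sub_le_of_iteratedDerivWithin (hJ : Convex ℝ J) (hf : DifferentiableOn ℝ f J)
    (hb : ∀ s ∈ J, ‖iteratedDerivWithin 1 f J s‖ ≤ c) (hs : s ∈ J) (ht : t ∈ J) :
    ‖f t - f s‖ ≤ c * |t - s| :=
  hJ.norm_image_sub_le_of_norm_derivWithin_le hf
    (fun x hx => by simpa only [iteratedDerivWithin_one] using hb x hx) hs ht

theorem norm_derivWithin_sub_le_of_iteratedDerivWithin (hJ : Convex ℝ J) (hu : UniqueDiffOn ℝ J)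
    (hf : ContDiffOn ℝ 2 f J) (hb : ∀ s ∈ J, ‖iteratedDerivWithin 2 f J s‖ ≤ c) (hs : s ∈ J)
    (ht : t ∈ J) : ‖derivWithin f J t - derivWithin f J s‖ ≤ c * |t - s| := by
  have hd : ContDiffOn ℝ 1 (derivWithin f J) J := hf.derivWithin hu one_add_one_eq_two.le
  refine norm_sub_le_of_iteratedDerivWithin hJ (hd.differentiableOn one_ne_zero)
    (fun x hx => ?_) hs ht
  rw [iteratedDerivWithin_one]
  simpa only [iteratedDerivWithin_succ, iteratedDerivWithin_zero] using hb x hx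

theorem norm_sub_sub_smul_derivWithin_le (hJ : Convex ℝ J) (hu : UniqueDiffOn ℝ J)
    (hf : ContDiffOn ℝ 2 f J) (hb : ∀ s ∈ J, ‖iteratedDerivWithin 2 f J s‖ ≤ c) (hs : s ∈ J)
    (ht : t ∈ J) : ‖f t - f s - (t - s) • derivWithin f J t‖ ≤ c * |t - s| ^ 2 := by
  set D := derivWithin f J
  have hsub : uIcc s t ⊆ J := hJ.ordConnected.uIcc_subset hs ht
  have hc : 0 ≤ c := (norm_nonneg _).trans (hb s hs)
  have hder : ∀ u ∈ uIcc s t,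
      HasDerivWithinAt (fun u => f u - u • D t) (D u - D t) (uIcc s t) u := fun u hu => by
    have hsmul : HasDerivWithinAt (fun u : ℝ => u • D t) ((1 : ℝ) • D t) (uIcc s t) u :=
      (hasDerivWithinAt_id u _).smul_const (D t)
    rw [one_smul] at hsmul
    exact ((hf.differentiableOn two_ne_zero u (hsub hu)).hasDerivWithinAt.mono hsub).sub hsmul
  have hbound : ∀ u ∈ uIcc s t, ‖D u - D t‖ ≤ c * |t - s| := fun u hu' => by
    refine (norm_derivWithin_sub_le_of_iteratedDerivWithin hJ hu hf hb ht (hsub hu')).trans ?_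
    rw [abs_sub_comm u]
    exact mul_le_mul_of_nonneg_left (abs_sub_right_of_mem_uIcc hu') hc
  calc ‖f t - f s - (t - s) • D t‖ = ‖(f t - t • D t) - (f s - s • D t)‖ := by
        rw [sub_smul, sub_sub_sub_comm]
    _ ≤ c * |t - s| * ‖t - s‖ := (convex_uIcc s t).norm_image_sub_le_of_norm_hasDerivWithin_le
        hder hbound left_mem_uIcc right_mem_uIcc
    _ = c * |t - s| ^ 2 := by rw [Real.norm_eq_abs, pow_two, mul_assoc]

end Taylor

end Calculus

section SmoothLabelling

variable {X : Type*} [NormedAddCommGroup X] [NormedSpace ℂ X] {L : ℝ → X →L[ℂ] X} {ε ℓ s : ℝ}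
  {N : ℕ} {e : Fin N → ℝ → ℂ}

theorem IsLabelling.peripheralProj_eq (he : IsLabelling L e) (hs : s ∈ Icc (0 : ℝ) 1) :
    peripheralProj (L s) = ∑ j, eigProj L e j s :=
  peripheralProj_eq_sum (he.injective s hs) (he.range_eq s hs)

variable [FiniteDimensional ℂ X]

theorem Hypotheses.isPeripheralFamily_eigProj (h : Hypotheses L ε ℓ) (he : IsLabelling L e)
    (hs : s ∈ Icc (0 : ℝ) 1) :
    IsPeripheralFamily (L s) (fun j => e j s) fun j => eigProj L e j s :=
  h.isPeripheralFamily hs (he.injective s hs) (he.range_eq s hs)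

theorem Hypotheses.mul_peripheralProj_eq (h : Hypotheses L ε ℓ) (he : IsLabelling L e)
    (hs : s ∈ Icc (0 : ℝ) 1) :
    L s * peripheralProj (L s) = ∑ j, e j s • eigProj L e j s := by
  rw [he.peripheralProj_eq hs, (h.isPeripheralFamily_eigProj he hs).mul_sum_proj]

theorem Hypotheses.contDiffOn_eigProj_of_eig (h : Hypotheses L ε ℓ) (he : IsLabelling L e)
    {n : WithTop ℕ∞} (hn : n ≤ 2) (hc : ∀ j, ContDiffOn ℝ n (e j) (Icc 0 1)) (j : Fin N) :
    ContDiffOn ℝ n (eigProj L e j) (Icc 0 1) := by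
  have hM : ContDiffOn ℝ n (fun s => L s * peripheralProj (L s)) (Icc 0 1) :=
    h.contDiffOn.of_le hn
  have hlagrange : ∀ s ∈ Icc (0 : ℝ) 1, eigProj L e j s =
      (e j s)⁻¹ • ((((Finset.univ.erase j).toList.map fun i =>
        (e j s - e i s)⁻¹ • ((L s * peripheralProj (L s)) - e i s • 1)).prod) *
          (L s * peripheralProj (L s))) := fun s hs => by
    have hfam := h.isPeripheralFamily_eigProj he hs
    rw [h.mul_peripheralProj_eq he hs]
    exact eq_smul_list_prod hfam.orthogonal (he.injective s hs) (hfam.eig_ne_zero j)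
  have hinv : ContDiffOn ℝ n (fun s => (e j s)⁻¹) (Icc 0 1) :=
    (hc j).fun_inv fun s hs => (h.isPeripheralFamily_eigProj he hs).eig_ne_zero j
  refine ContDiffOn.congr ?_ hlagrange
  refine hinv.fun_smul (ContDiffOn.mul (contDiffOn_list_prod fun i hi => ?_) hM)
  have hij : j ≠ i := (Finset.ne_of_mem_erase (Finset.mem_toList.1 hi)).symm
  have hne (s : ℝ) (hs : s ∈ Icc (0 : ℝ) 1) : e j s - e i s ≠ 0 :=
    sub_ne_zero.2 ((he.injective s hs).ne hij)
  exact (((hc j).sub (hc i)).fun_inv hne).fun_smul (hM.sub ((hc i).fun_smul contDiffOn_const))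

theorem Hypotheses.hasDerivWithinAt_eig (h : Hypotheses L ε ℓ) (he : IsLabelling L e) (j : Fin N)
    (hs : s ∈ Icc (0 : ℝ) 1) :
    HasDerivWithinAt (e j) (traceCLM X (eigProj L e j s *
      derivWithin (fun s => L s * peripheralProj (L s)) (Icc 0 1) s * eigProj L e j s))
      (Icc 0 1) s := by
  have hfam {t : ℝ} (ht : t ∈ Icc (0 : ℝ) 1) := h.isPeripheralFamily_eigProj he ht
  have hcont : ContinuousOn (eigProj L e j) (Icc 0 1) :=
    contDiffOn_zero.1 (h.contDiffOn_eigProj_of_eig he zero_le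
      (fun j => contDiffOn_zero.2 (he.continuousOn j)) j)
  refine hasDerivWithinAt_eigenvalue (hcont s hs)
    (h.contDiffOn.differentiableOn two_ne_zero s hs).hasDerivWithinAt ?_ ?_ fun t ht => ?_
  · rw [((hfam hs).orthogonal.idem j).eq]
    exact (hfam hs).trace_eq j
  · rw [h.mul_peripheralProj_eq he hs]
    exact proj_mul_sum_smul (hfam hs).orthogonal _ j
  · rw [h.mul_peripheralProj_eq he ht]
    exact sum_smul_mul_proj (hfam ht).orthogonal _ j

theorem Hypotheses.contDiffOn_eig_succ (h : Hypotheses L ε ℓ) (he : IsLabelling L e) {n : ℕ}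
    (hn : n + 1 ≤ 2) (hc : ∀ j, ContDiffOn ℝ n (e j) (Icc 0 1)) (j : Fin N) :
    ContDiffOn ℝ (n + 1 : ℕ) (e j) (Icc 0 1) := by
  have hu : UniqueDiffOn ℝ (Icc (0 : ℝ) 1) := uniqueDiffOn_Icc_zero_one
  have hn' : (n : WithTop ℕ∞) + 1 ≤ 2 := by exact_mod_cast hn
  have hp := h.contDiffOn_eigProj_of_eig he (le_self_add.trans hn') hc j
  have hderiv := (hp.mul (h.contDiffOn.derivWithin hu hn')).mul hp
  rw [Nat.cast_add, Nat.cast_one, contDiffOn_succ_iff_derivWithin hu]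
  refine ⟨fun s hs => (h.hasDerivWithinAt_eig he j hs).differentiableWithinAt, by simp, ?_⟩
  exact (((traceCLM X).restrictScalars ℝ).contDiff.comp_contDiffOn hderiv).congr
    fun s hs => (h.hasDerivWithinAt_eig he j hs).derivWithin (hu s hs)

theorem Hypotheses.contDiffOn_eig (h : Hypotheses L ε ℓ) (he : IsLabelling L e) (j : Fin N) :
    ContDiffOn ℝ 2 (e j) (Icc 0 1) := by
  have hzero (j : Fin N) : ContDiffOn ℝ (0 : ℕ) (e j) (Icc 0 1) :=
    contDiffOn_zero.2 (he.continuousOn j)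
  exact_mod_cast h.contDiffOn_eig_succ he le_rfl (h.contDiffOn_eig_succ he one_le_two hzero) j

theorem Hypotheses.contDiffOn_eigProj (h : Hypotheses L ε ℓ) (he : IsLabelling L e) (j : Fin N) :
    ContDiffOn ℝ 2 (eigProj L e j) (Icc 0 1) :=
  h.contDiffOn_eigProj_of_eig he le_rfl (h.contDiffOn_eig he) j

theorem Hypotheses.exists_derivBound (h : Hypotheses L ε ℓ) (he : IsLabelling L e) :
    ∃ c, 0 ≤ c ∧ DerivBound L e c := by
  obtain ⟨a, ha⟩ := exists_norm_iteratedDerivWithin_le isCompact_Icc uniqueDiffOn_Icc_zero_one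
    (n := 2) (h.contDiffOn_eigProj he)
  obtain ⟨b, hb⟩ := exists_norm_iteratedDerivWithin_le isCompact_Icc uniqueDiffOn_Icc_zero_one
    (n := 2) (h.contDiffOn_eig he)
  refine ⟨max 0 (max a b), le_max_left _ _, fun s hs j α hα => ⟨?_, ?_⟩⟩
  · exact (ha s hs j α hα.2).trans (le_max_of_le_right (le_max_left a b))
  · exact (hb s hs j α hα.2).trans (le_max_of_le_right (le_max_right a b))

theorem Hypotheses.eigProj_mul_derivWithin_eigProj (h : Hypotheses L ε ℓ) (he : IsLabelling L e)
    {i j : Fin N} (hij : j ≠ i) (hs : s ∈ Icc (0 : ℝ) 1) :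
    eigProj L e j s * derivWithin (eigProj L e i) (Icc 0 1) s =
      -(derivWithin (eigProj L e j) (Icc 0 1) s * eigProj L e i s) := by
  have hdiff (k : Fin N) := (h.contDiffOn_eigProj he k).differentiableOn two_ne_zero s hs
  exact mul_derivWithin_eq_neg (hdiff j) (hdiff i)
    (fun t ht => (h.isPeripheralFamily_eigProj he ht).orthogonal.ortho hij) hs
    (uniqueDiffOn_Icc_zero_one s hs)

end SmoothLabelling

section MurrayVonNeumann

/-- `u` and `v` implement a Murray–von Neumann equivalence of the idempotents `p` and `q`: `u` maps
the range of `p` onto the range of `q` and `v` inverts it. -/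
structure IsMvNEquiv {R : Type*} [Mul R] (p q u v : R) : Prop where
  map_source : u * p = u
  target_map : q * u = u
  inv_target : v * q = v
  source_inv : p * v = v
  inv_map : v * u = p
  map_inv : u * v = q

namespace IsMvNEquiv

theorem refl {R : Type*} [Mul R] {p : R} (hp : IsIdempotentElem p) : IsMvNEquiv p p p p :=
  ⟨hp, hp, hp, hp, hp, hp⟩

theorem trans {R : Type*} [Semigroup R] {p q r u v u' v' : R} (h : IsMvNEquiv p q u v)
    (h' : IsMvNEquiv q r u' v') : IsMvNEquiv p r (u' * u) (v * v') where
  map_source := by rw [mul_assoc, h.map_source]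
  target_map := by rw [← mul_assoc, h'.target_map]
  inv_target := by rw [mul_assoc, h'.inv_target]
  source_inv := by rw [← mul_assoc, h.source_inv]
  inv_map := by rw [mul_assoc, ← mul_assoc v', h'.inv_map, h.target_map, h.inv_map]
  map_inv := by rw [mul_assoc, ← mul_assoc u, h.map_inv, h'.source_inv, h'.map_inv]

theorem smul {k R : Type*} [CommSemiring k] [Semiring R] [Algebra k R] {p q u v : R} {c d : k}
    (h : IsMvNEquiv p q u v) (hcd : c * d = 1) : IsMvNEquiv p q (c • u) (d • v) where
  map_source := by rw [smul_mul_assoc, h.map_source]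
  target_map := by rw [mul_smul_comm, h.target_map]
  inv_target := by rw [smul_mul_assoc, h.inv_target]
  source_inv := by rw [mul_smul_comm, h.source_inv]
  inv_map := by rw [smul_mul_smul_comm, h.inv_map, mul_comm, hcd, one_smul]
  map_inv := by rw [smul_mul_smul_comm, h.map_inv, hcd, one_smul]

end IsMvNEquiv

variable {R ι : Type*} [Semiring R] [Fintype ι] {p q r u v : ι → R}

theorem sum_mul_eq_of_mul_eq_self (hp : OrthogonalIdempotents p) (hu : ∀ i, u i * p i = u i)
    (j : ι) : (∑ i, u i) * p j = u j := by
  rw [Finset.sum_mul, Finset.sum_eq_single j (fun i _ hij => ?_) (by simp), hu]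
  rw [← hu i, mul_assoc, hp.ortho hij, mul_zero]

theorem mul_sum_eq_of_mul_eq_self (hq : OrthogonalIdempotents q) (hu : ∀ i, q i * u i = u i)
    (j : ι) : q j * ∑ i, u i = u j := by
  rw [Finset.mul_sum, Finset.sum_eq_single j (fun i _ hij => ?_) (by simp), hu]
  rw [← hu i, ← mul_assoc, hq.ortho hij.symm, zero_mul]

/-- A Murray–von Neumann equivalence of `∑ j, p j` and `∑ j, q j` that restricts to one of `p j` and
`q j` for every `j`. -/
structure IsFamilyEquiv (p q : ι → R) (U V : R) : Prop
    extends IsMvNEquiv (∑ j, p j) (∑ j, q j) U V where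
  map_mul : ∀ j, U * p j = q j * U
  inv_mul : ∀ j, V * q j = p j * V

namespace IsFamilyEquiv

theorem trans {U V U' V' : R} (h : IsFamilyEquiv p q U V) (h' : IsFamilyEquiv q r U' V') :
    IsFamilyEquiv p r (U' * U) (V * V') where
  toIsMvNEquiv := h.toIsMvNEquiv.trans h'.toIsMvNEquiv
  map_mul j := by rw [mul_assoc, h.map_mul, ← mul_assoc, h'.map_mul, mul_assoc]
  inv_mul j := by rw [mul_assoc, h'.inv_mul, ← mul_assoc, h.inv_mul, mul_assoc]

theorem of_isMvNEquiv (hp : OrthogonalIdempotents p) (hq : OrthogonalIdempotents q)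
    (h : ∀ j, IsMvNEquiv (p j) (q j) (u j) (v j)) : IsFamilyEquiv p q (∑ j, u j) (∑ j, v j) := by
  have hup := sum_mul_eq_of_mul_eq_self hp fun j => (h j).map_source
  have hqu := mul_sum_eq_of_mul_eq_self hq fun j => (h j).target_map
  have hvq := sum_mul_eq_of_mul_eq_self hq fun j => (h j).inv_target
  have hpv := mul_sum_eq_of_mul_eq_self hp fun j => (h j).source_inv
  refine ⟨⟨?_, ?_, ?_, ?_, ?_, ?_⟩, fun j => (hup j).trans (hqu j).symm,
    fun j => (hvq j).trans (hpv j).symm⟩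
  · simp only [Finset.mul_sum, hup]
  · simp only [Finset.sum_mul, hqu]
  · simp only [Finset.mul_sum, hvq]
  · simp only [Finset.sum_mul, hpv]
  · rw [Finset.mul_sum]
    exact Finset.sum_congr rfl fun j _ => by
      rw [← (h j).target_map, ← mul_assoc, hvq, (h j).inv_map]
  · rw [Finset.mul_sum]
    exact Finset.sum_congr rfl fun j _ => by
      rw [← (h j).source_inv, ← mul_assoc, hup, (h j).map_inv]

end IsFamilyEquiv

end MurrayVonNeumann

section KatoTerm

variable {X : Type*} [NormedAddCommGroup X] [NormedSpace ℂ X] {p q : X →L[ℂ] X} {x : ℝ}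

/-- Kato's map `p q (1 - (p - q)²)^(-1/2)` from the range of `q` to the range of `p`. -/
def katoTerm (p q : X →L[ℂ] X) : X →L[ℂ] X :=
  p * q * invSqrtOneSub ((p - q) ^ 2)

theorem commute_sub_sq {R : Type*} [Ring R] {p q : R} (hp : IsIdempotentElem p)
    (hq : IsIdempotentElem q) : Commute p ((p - q) ^ 2) := by
  have hsq : (p - q) ^ 2 = p + q - p * q - q * p := by
    simp only [pow_two, mul_sub, sub_mul, hp.eq, hq.eq]
    abel
  rw [hsq, Commute, SemiconjBy]
  simp only [mul_sub, mul_add, sub_mul, add_mul, hp.mul_mul_self, hp.eq, ← mul_assoc]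
  abel

theorem norm_sub_sq_le (hx : ‖p - q‖ ≤ x) : ‖(p - q) ^ 2‖ ≤ x ^ 2 :=
  (norm_pow_le' _ two_pos).trans (pow_le_pow_left₀ (norm_nonneg _) hx 2)

theorem norm_sub_sq_lt_one (h : ‖p - q‖ < 1) : ‖(p - q) ^ 2‖ < 1 :=
  (norm_sub_sq_le le_rfl).trans_lt (pow_lt_one₀ (norm_nonneg _) h two_ne_zero)

theorem norm_katoTerm_le (hp : ‖p‖ ≤ 1) (hq : ‖q‖ ≤ 1) (hx : ‖p - q‖ ≤ x) (hx1 : x < 1) :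
    ‖katoTerm p q‖ ≤ (1 - x ^ 2) ^ (-(1 / 2) : ℝ) := by
  have hx2 : x ^ 2 < 1 := pow_lt_one₀ ((norm_nonneg _).trans hx) hx1 two_ne_zero
  have hB := norm_sub_sq_le hx
  have hS : ‖invSqrtOneSub ((p - q) ^ 2)‖ ≤ (1 - x ^ 2) ^ (-(1 / 2) : ℝ) :=
    (norm_invSqrtOneSub_le (hB.trans_lt hx2)).trans
      (Real.rpow_le_rpow_of_nonpos (by linarith) (by linarith) (by norm_num))
  calc ‖katoTerm p q‖ ≤ ‖p‖ * ‖q‖ * ‖invSqrtOneSub ((p - q) ^ 2)‖ := norm_mul₃_le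
    _ ≤ 1 * 1 * (1 - x ^ 2) ^ (-(1 / 2) : ℝ) := by gcongr
    _ = (1 - x ^ 2) ^ (-(1 / 2) : ℝ) := by rw [one_mul, one_mul]

variable [CompleteSpace X]

theorem norm_katoTerm_sub_le (hp : ‖p‖ ≤ 1) (hq : ‖q‖ ≤ 1) (hx : ‖p - q‖ ≤ x) (hx1 : x ≤ 1 / 2) :
    ‖katoTerm p q - p * q‖ ≤ 2 * x ^ 2 := by
  have hB := norm_sub_sq_le hx
  have hx2 : x ^ 2 ≤ 1 / 4 := by nlinarith [(norm_nonneg _).trans hx]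
  have hS : ‖invSqrtOneSub ((p - q) ^ 2) - 1‖ ≤ 2 * x ^ 2 := by
    refine (norm_invSqrtOneSub_sub_one_le (by linarith)).trans ?_
    rw [div_le_iff₀ (by linarith)]
    nlinarith [norm_nonneg ((p - q) ^ 2)]
  calc ‖katoTerm p q - p * q‖ = ‖p * q * (invSqrtOneSub ((p - q) ^ 2) - 1)‖ := by
        rw [katoTerm, mul_sub, mul_one]
    _ ≤ ‖p‖ * ‖q‖ * ‖invSqrtOneSub ((p - q) ^ 2) - 1‖ := norm_mul₃_le
    _ ≤ 1 * 1 * (2 * x ^ 2) := by gcongr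
    _ = 2 * x ^ 2 := by rw [one_mul, one_mul]

theorem norm_katoTerm_sub_left_le (hp : ‖p‖ ≤ 1) (hpp : IsIdempotentElem p) (hq : ‖q‖ ≤ 1)
    (hx : ‖p - q‖ ≤ x) (hx1 : x ≤ 1 / 2) : ‖katoTerm p q - p‖ ≤ 2 * x := by
  have hx0 : 0 ≤ x := (norm_nonneg _).trans hx
  calc ‖katoTerm p q - p‖ = ‖(katoTerm p q - p * q) - p * (p - q)‖ := by
        rw [mul_sub, hpp.eq, sub_sub_sub_cancel_right]
    _ ≤ 2 * x ^ 2 + 1 * x :=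
        norm_sub_le_of_le (norm_katoTerm_sub_le hp hq hx hx1) (norm_mul_le_of_le hp hx)
    _ ≤ 2 * x := by nlinarith

theorem commute_invSqrtOneSub_sub_sq (hp : IsIdempotentElem p) (hq : IsIdempotentElem q)
    (h : ‖p - q‖ < 1) : Commute p (invSqrtOneSub ((p - q) ^ 2)) :=
  commute_invSqrtOneSub (norm_sub_sq_lt_one h) (commute_sub_sq hp hq)

theorem commute_invSqrtOneSub_sub_sq' (hp : IsIdempotentElem p) (hq : IsIdempotentElem q)
    (h : ‖p - q‖ < 1) : Commute q (invSqrtOneSub ((p - q) ^ 2)) := by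
  rw [← neg_sub q p, neg_sq]
  exact commute_invSqrtOneSub_sub_sq hq hp (norm_sub_rev p q ▸ h)

theorem katoTerm_mul (hp : IsIdempotentElem p) (hq : IsIdempotentElem q) (h : ‖p - q‖ < 1) :
    katoTerm p q * q = katoTerm p q := by
  rw [katoTerm, mul_assoc, ← (commute_invSqrtOneSub_sub_sq' hp hq h).eq, ← mul_assoc,
    hq.mul_mul_self]

theorem katoTerm_mul_katoTerm (hp : IsIdempotentElem p) (hq : IsIdempotentElem q)
    (h : ‖p - q‖ < 1) : katoTerm q p * katoTerm p q = q := by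
  have hB := norm_sub_sq_lt_one h
  set S := invSqrtOneSub ((p - q) ^ 2) with hS
  have hqp : katoTerm q p = q * p * S := by rw [katoTerm, hS, ← neg_sub p q, neg_sq]
  have hcomm : S * (p * q) = p * q * S :=
    ((commute_invSqrtOneSub_sub_sq hp hq h).mul_left
      (commute_invSqrtOneSub_sub_sq' hp hq h)).eq.symm
  have hqpq : q * p * q = q * (1 - (p - q) ^ 2) := by
    simp only [pow_two, mul_sub, sub_mul, hp.eq, hq.eq, mul_one, ← mul_assoc]
    abel
  have hSB : (1 - (p - q) ^ 2) * (S * S) = 1 := by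
    have hc : Commute (1 - (p - q) ^ 2) S :=
      commute_invSqrtOneSub hB ((Commute.one_left _).sub_left (Commute.refl _))
    rw [(hc.mul_right hc).eq]
    exact invSqrtOneSub_mul_self_mul hB
  calc katoTerm q p * katoTerm p q = q * p * (S * (p * q)) * S := by
        rw [hqp, katoTerm]
        simp only [mul_assoc, hS]
    _ = q * p * q * (S * S) := by
        rw [hcomm, ← mul_assoc (q * p), ← mul_assoc (q * p), hp.mul_mul_self]
        simp only [mul_assoc]
    _ = q := by rw [hqpq, mul_assoc, hSB, mul_one]

theorem isMvNEquiv_katoTerm (hp : IsIdempotentElem p) (hq : IsIdempotentElem q)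
    (h : ‖p - q‖ < 1) : IsMvNEquiv q p (katoTerm p q) (katoTerm q p) where
  map_source := katoTerm_mul hp hq h
  target_map := by rw [katoTerm, ← mul_assoc, ← mul_assoc, hp.eq]
  inv_target := katoTerm_mul hq hp (norm_sub_rev p q ▸ h)
  source_inv := by rw [katoTerm, ← mul_assoc, ← mul_assoc, hq.eq]
  inv_map := katoTerm_mul_katoTerm hp hq h
  map_inv := katoTerm_mul_katoTerm hq hp (norm_sub_rev p q ▸ h)

end KatoTerm

section Rpow

theorem rpow_one_sub_sq_div_le {c a b : ℝ} (ha : 0 < a) (hca : |c| ≤ a) (hab : a ≤ b) :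
    (1 - (c / a) ^ 2) ^ a ≤ (1 - (c / b) ^ 2) ^ b := by
  have hb : 0 < b := ha.trans_le hab
  have hsq_le_one {d : ℝ} (hd : 0 < d) (hcd : |c| ≤ d) : (c / d) ^ 2 ≤ 1 := by
    rw [sq_le_one_iff_abs_le_one, abs_div, abs_of_pos hd]
    exact (div_le_one hd).2 hcd
  have hsqa := hsq_le_one ha hca
  have hsqb := hsq_le_one hb (hca.trans hab)
  have hbernoulli : 1 - (c / a) ^ 2 ≤ (1 - (c / b) ^ 2) ^ (b / a) :=
    calc 1 - (c / a) ^ 2 ≤ 1 - c ^ 2 / (a * b) := by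
          rw [div_pow, pow_two a]
          gcongr
      _ = 1 + b / a * -(c / b) ^ 2 := by field_simp; ring
      _ ≤ (1 + -(c / b) ^ 2) ^ (b / a) :=
          one_add_mul_self_le_rpow_one_add (by linarith) ((one_le_div ha).2 hab)
      _ = (1 - (c / b) ^ 2) ^ (b / a) := by rw [← sub_eq_add_neg]
  calc (1 - (c / a) ^ 2) ^ a ≤ ((1 - (c / b) ^ 2) ^ (b / a)) ^ a :=
        Real.rpow_le_rpow (by linarith) hbernoulli ha.le
    _ = (1 - (c / b) ^ 2) ^ b := by
        rw [← Real.rpow_mul (by linarith), div_mul_cancel₀ _ ha.ne']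

theorem rpow_one_sub_sq_div_pow_le {c a : ℝ} (hca : |c| < a) {T k : ℕ} (hT : a ≤ T)
    (hk : k ≤ T) :
    ((1 - (c / T) ^ 2) ^ (-(1 / 2) : ℝ)) ^ k ≤ (1 - c ^ 2 / a ^ 2) ^ (-a / 2) := by
  have ha : 0 < a := (abs_nonneg c).trans_lt hca
  have hpos {d : ℝ} (had : a ≤ d) : 0 < 1 - (c / d) ^ 2 := by
    have hd : 0 < d := ha.trans_le had
    rw [sub_pos, sq_lt_one_iff_abs_lt_one, abs_div, abs_of_pos hd]
    exact (div_lt_one hd).2 (hca.trans_le had)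
  have hone : 1 ≤ (1 - (c / T) ^ 2) ^ (-(1 / 2) : ℝ) :=
    Real.one_le_rpow_of_pos_of_le_one_of_nonpos (hpos hT) (sub_le_self 1 (sq_nonneg _))
      (by norm_num)
  calc ((1 - (c / T) ^ 2) ^ (-(1 / 2) : ℝ)) ^ k
      ≤ ((1 - (c / T) ^ 2) ^ (-(1 / 2) : ℝ)) ^ T := pow_le_pow_right₀ hone hk
    _ = ((1 - (c / T) ^ 2) ^ (T : ℝ)) ^ (-(1 / 2) : ℝ) := by
        rw [← Real.rpow_natCast, ← Real.rpow_mul (hpos hT).le, ← Real.rpow_mul (hpos hT).le,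
          mul_comm]
    _ ≤ ((1 - (c / a) ^ 2) ^ a) ^ (-(1 / 2) : ℝ) :=
        Real.rpow_le_rpow_of_nonpos (Real.rpow_pos_of_pos (hpos le_rfl) _)
          (rpow_one_sub_sq_div_le ha hca.le hT) (by norm_num)
    _ = (1 - c ^ 2 / a ^ 2) ^ (-a / 2) := by
        rw [← Real.rpow_mul (hpos le_rfl).le, div_pow]
        congr 1
        ring

end Rpow

section AdiabaticMap

variable {X : Type*} [NormedAddCommGroup X] [NormedSpace ℂ X] {L : ℝ → X →L[ℂ] X} {N : ℕ}
  {e : Fin N → ℝ → ℂ} {T k : ℕ} {x : ℝ}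

theorem katoStep_succ : katoStep L e T (k + 1) =
    ∑ j, katoTerm (eigProjAt L e T j (k + 1)) (eigProjAt L e T j k) := rfl

theorem katoStepDagger_succ : katoStepDagger L e T (k + 1) =
    ∑ j, katoTerm (eigProjAt L e T j k) (eigProjAt L e T j (k + 1)) := by
  refine Finset.sum_congr rfl fun j _ => ?_
  rw [katoTerm, ← neg_sub (eigProjAt L e T j (k + 1)), neg_sq]
  rfl

/-- For every `k ≤ T` the projections `P^j_k` are orthogonal idempotents of norm at most one and the
`e^j_k` are phases, and consecutive projections are at distance at most `x < 1`. -/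
structure IsSlowLabelling (L : ℝ → X →L[ℂ] X) (e : Fin N → ℝ → ℂ) (T : ℕ) (x : ℝ) : Prop where
  orthogonal : ∀ k ≤ T, OrthogonalIdempotents fun j => eigProjAt L e T j k
  norm_le_one : ∀ k ≤ T, ∀ j, ‖eigProjAt L e T j k‖ ≤ 1
  norm_eig : ∀ k ≤ T, ∀ j, ‖e j (k / T : ℝ)‖ = 1
  norm_sub_le : ∀ k < T, ∀ j, ‖eigProjAt L e T j (k + 1) - eigProjAt L e T j k‖ ≤ x
  lt_one : x < 1

namespace IsSlowLabelling

variable (h : IsSlowLabelling L e T x)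
include h

theorem norm_katoTerm_le (hk : k < T) (j : Fin N) :
    ‖katoTerm (eigProjAt L e T j (k + 1)) (eigProjAt L e T j k)‖ ≤
      (1 - x ^ 2) ^ (-(1 / 2) : ℝ) :=
  Adiabatic.norm_katoTerm_le (h.norm_le_one _ hk j) (h.norm_le_one _ hk.le j)
    (h.norm_sub_le k hk j) h.lt_one

theorem norm_katoTerm_rev_le (hk : k < T) (j : Fin N) :
    ‖katoTerm (eigProjAt L e T j k) (eigProjAt L e T j (k + 1))‖ ≤
      (1 - x ^ 2) ^ (-(1 / 2) : ℝ) :=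
  Adiabatic.norm_katoTerm_le (h.norm_le_one _ hk.le j) (h.norm_le_one _ hk j)
    ((norm_sub_rev _ _).trans_le (h.norm_sub_le k hk j)) h.lt_one

theorem isFamilyEquiv_sum_smul (hk : k ≤ T) :
    IsFamilyEquiv (fun j => eigProjAt L e T j k) (fun j => eigProjAt L e T j k)
      (∑ j, e j (k / T : ℝ) • eigProjAt L e T j k)
      (∑ j, (starRingEnd ℂ) (e j (k / T : ℝ)) • eigProjAt L e T j k) := by
  have hp := h.orthogonal k hk
  refine .of_isMvNEquiv hp hp fun j => (IsMvNEquiv.refl (hp.idem j)).smul ?_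
  rw [Complex.mul_conj', h.norm_eig k hk j, Complex.ofReal_one, one_pow]

theorem phase_succ (hT : 0 < T) : phase L e T (k + 1) =
    (∑ j, e j ((k + 1 : ℕ) / T : ℝ) • eigProjAt L e T j 0) * phase L e T k := by
  rw [phase, phase, sum_smul_mul_sum_smul (h.orthogonal 0 hT.le)]
  simp only [Finset.prod_Icc_succ_top (Nat.le_add_left 1 k), mul_comm]

theorem phaseDagger_succ (hT : 0 < T) : phaseDagger L e T (k + 1) = phaseDagger L e T k *
    ∑ j, (starRingEnd ℂ) (e j ((k + 1 : ℕ) / T : ℝ)) • eigProjAt L e T j 0 := by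
  rw [phaseDagger, phaseDagger, sum_smul_mul_sum_smul (h.orthogonal 0 hT.le)]
  simp only [Finset.prod_Icc_succ_top (Nat.le_add_left 1 k)]

variable [CompleteSpace X]

theorem isMvNEquiv_katoTerm (hk : k < T) (j : Fin N) :
    IsMvNEquiv (eigProjAt L e T j k) (eigProjAt L e T j (k + 1))
      (katoTerm (eigProjAt L e T j (k + 1)) (eigProjAt L e T j k))
      (katoTerm (eigProjAt L e T j k) (eigProjAt L e T j (k + 1))) :=
  Adiabatic.isMvNEquiv_katoTerm ((h.orthogonal _ hk).idem j) ((h.orthogonal _ hk.le).idem j)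
    ((h.norm_sub_le k hk j).trans_lt h.lt_one)

theorem isFamilyEquiv_katoStep (hk : k < T) :
    IsFamilyEquiv (fun j => eigProjAt L e T j k) (fun j => eigProjAt L e T j (k + 1))
      (katoStep L e T (k + 1)) (katoStepDagger L e T (k + 1)) := by
  rw [katoStep_succ, katoStepDagger_succ]
  exact .of_isMvNEquiv (h.orthogonal _ hk.le) (h.orthogonal _ hk) (h.isMvNEquiv_katoTerm hk)

theorem katoStep_mul (hk : k < T) (j : Fin N) : katoStep L e T (k + 1) * eigProjAt L e T j k =
    katoTerm (eigProjAt L e T j (k + 1)) (eigProjAt L e T j k) := by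
  rw [katoStep_succ]
  exact sum_mul_eq_of_mul_eq_self (h.orthogonal _ hk.le)
    (fun j => (h.isMvNEquiv_katoTerm hk j).map_source) j

theorem mul_katoStepDagger (hk : k < T) (j : Fin N) :
    eigProjAt L e T j k * katoStepDagger L e T (k + 1) =
      katoTerm (eigProjAt L e T j k) (eigProjAt L e T j (k + 1)) := by
  rw [katoStepDagger_succ]
  exact mul_sum_eq_of_mul_eq_self (h.orthogonal _ hk.le)
    (fun j => (h.isMvNEquiv_katoTerm hk j).source_inv) j

theorem orderedProd_mul (hk : k ≤ T) (j : Fin N) :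
    orderedProd (katoStep L e T) k * eigProjAt L e T j 0 =
      eigProjAt L e T j k * orderedProd (katoStep L e T) k := by
  induction k with
  | zero => rw [orderedProd, one_mul, mul_one]
  | succ k ih =>
    rw [orderedProd, mul_assoc, ih (Nat.le_of_succ_le hk), ← mul_assoc,
      (h.isFamilyEquiv_katoStep hk).map_mul, mul_assoc]

theorem mul_revOrderedProd (hk : k ≤ T) (j : Fin N) :
    eigProjAt L e T j 0 * revOrderedProd (katoStepDagger L e T) k =
      revOrderedProd (katoStepDagger L e T) k * eigProjAt L e T j k := by
  induction k with
  | zero => rw [revOrderedProd, one_mul, mul_one]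
  | succ k ih =>
    rw [revOrderedProd, ← mul_assoc, ih (Nat.le_of_succ_le hk), mul_assoc,
      ← (h.isFamilyEquiv_katoStep hk).inv_mul, mul_assoc]

theorem adiabaticMap_succ (hk : k < T) : adiabaticMap L e T (k + 1) =
    (∑ j, e j ((k + 1 : ℕ) / T : ℝ) • eigProjAt L e T j (k + 1)) *
      (katoStep L e T (k + 1) * adiabaticMap L e T k) := by
  rw [adiabaticMap, h.phase_succ (Nat.zero_lt_of_lt hk), ← mul_assoc, Finset.mul_sum]
  simp only [mul_smul_comm, h.orderedProd_mul hk]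
  simp only [← smul_mul_assoc, ← Finset.sum_mul]
  rw [orderedProd, adiabaticMap, mul_assoc, mul_assoc]

theorem adiabaticMapDagger_succ (hk : k < T) : adiabaticMapDagger L e T (k + 1) =
    adiabaticMapDagger L e T k * katoStepDagger L e T (k + 1) *
      ∑ j, (starRingEnd ℂ) (e j ((k + 1 : ℕ) / T : ℝ)) • eigProjAt L e T j (k + 1) := by
  rw [adiabaticMapDagger, h.phaseDagger_succ (Nat.zero_lt_of_lt hk), mul_assoc, Finset.sum_mul]
  simp only [smul_mul_assoc, h.mul_revOrderedProd hk]
  simp only [← mul_smul_comm, ← Finset.mul_sum]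
  rw [revOrderedProd, adiabaticMapDagger]
  simp only [mul_assoc]

theorem isFamilyEquiv_adiabaticMap (hk : k ≤ T) :
    IsFamilyEquiv (fun j => eigProjAt L e T j 0) (fun j => eigProjAt L e T j k)
      (adiabaticMap L e T k) (adiabaticMapDagger L e T k) := by
  induction k with
  | zero =>
    have hp := h.orthogonal 0 hk
    simpa [adiabaticMap, adiabaticMapDagger, orderedProd, revOrderedProd, phase, phaseDagger] using
      IsFamilyEquiv.of_isMvNEquiv hp hp fun j => .refl (hp.idem j)
  | succ k ih =>
    rw [h.adiabaticMap_succ hk, h.adiabaticMapDagger_succ hk,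
      mul_assoc (adiabaticMapDagger L e T k), ← mul_assoc (∑ j, _)]
    exact (ih (Nat.le_of_succ_le hk)).trans
      ((h.isFamilyEquiv_katoStep hk).trans (h.isFamilyEquiv_sum_smul hk))

theorem norm_orderedProd_mul_le (hk : k ≤ T) (j : Fin N) :
    ‖orderedProd (katoStep L e T) k * eigProjAt L e T j 0‖ ≤
      ((1 - x ^ 2) ^ (-(1 / 2) : ℝ)) ^ k := by
  induction k with
  | zero => simpa [orderedProd] using h.norm_le_one 0 hk j
  | succ k ih =>
    have hstep : orderedProd (katoStep L e T) (k + 1) * eigProjAt L e T j 0 =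
        katoTerm (eigProjAt L e T j (k + 1)) (eigProjAt L e T j k) *
          (orderedProd (katoStep L e T) k * eigProjAt L e T j 0) := by
      rw [← h.katoStep_mul hk, mul_assoc (katoStep L e T (k + 1)),
        h.orderedProd_mul (Nat.le_of_succ_le hk), ← mul_assoc (eigProjAt L e T j k),
        ((h.orthogonal k (Nat.le_of_succ_le hk)).idem j).eq,
        ← h.orderedProd_mul (Nat.le_of_succ_le hk), orderedProd, mul_assoc]
    rw [hstep, pow_succ']
    exact norm_mul_le_of_le (h.norm_katoTerm_le hk j) (ih (Nat.le_of_succ_le hk))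

theorem norm_mul_revOrderedProd_le (hk : k ≤ T) (j : Fin N) :
    ‖eigProjAt L e T j 0 * revOrderedProd (katoStepDagger L e T) k‖ ≤
      ((1 - x ^ 2) ^ (-(1 / 2) : ℝ)) ^ k := by
  induction k with
  | zero => simpa [revOrderedProd] using h.norm_le_one 0 hk j
  | succ k ih =>
    have hstep : eigProjAt L e T j 0 * revOrderedProd (katoStepDagger L e T) (k + 1) =
        eigProjAt L e T j 0 * revOrderedProd (katoStepDagger L e T) k *
          katoTerm (eigProjAt L e T j k) (eigProjAt L e T j (k + 1)) := by
      rw [← h.mul_katoStepDagger hk, ← mul_assoc, h.mul_revOrderedProd (Nat.le_of_succ_le hk),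
        mul_assoc _ (eigProjAt L e T j k) (eigProjAt L e T j k),
        ((h.orthogonal k (Nat.le_of_succ_le hk)).idem j).eq,
        ← h.mul_revOrderedProd (Nat.le_of_succ_le hk), revOrderedProd, mul_assoc]
    rw [hstep, pow_succ]
    exact norm_mul_le_of_le (ih (Nat.le_of_succ_le hk)) (h.norm_katoTerm_rev_le hk j)

theorem norm_adiabaticMap_le (hk : k ≤ T) :
    ‖adiabaticMap L e T k‖ ≤ N * ((1 - x ^ 2) ^ (-(1 / 2) : ℝ)) ^ k := by
  have hterm (j : Fin N) : ‖orderedProd (katoStep L e T) k *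
      ((∏ n ∈ Finset.Icc 1 k, e j (n / T : ℝ)) • eigProjAt L e T j 0)‖ ≤
        ((1 - x ^ 2) ^ (-(1 / 2) : ℝ)) ^ k := by
    rw [mul_smul_comm, norm_smul, norm_prod, Finset.prod_eq_one fun n hn =>
      h.norm_eig n ((Finset.mem_Icc.1 hn).2.trans hk) j, one_mul]
    exact h.norm_orderedProd_mul_le hk j
  rw [adiabaticMap, phase, Finset.mul_sum]
  simpa using norm_sum_le_of_le Finset.univ fun j _ => hterm j

theorem norm_adiabaticMapDagger_le (hk : k ≤ T) :
    ‖adiabaticMapDagger L e T k‖ ≤ N * ((1 - x ^ 2) ^ (-(1 / 2) : ℝ)) ^ k := by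
  have hterm (j : Fin N) : ‖(∏ n ∈ Finset.Icc 1 k, (starRingEnd ℂ) (e j (n / T : ℝ))) •
      eigProjAt L e T j 0 * revOrderedProd (katoStepDagger L e T) k‖ ≤
        ((1 - x ^ 2) ^ (-(1 / 2) : ℝ)) ^ k := by
    rw [smul_mul_assoc, norm_smul, norm_prod, Finset.prod_eq_one fun n hn =>
      (RCLike.norm_conj _).trans (h.norm_eig n ((Finset.mem_Icc.1 hn).2.trans hk) j), one_mul]
    exact h.norm_mul_revOrderedProd_le hk j
  rw [adiabaticMapDagger, phaseDagger, Finset.sum_mul]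
  simpa using norm_sum_le_of_le Finset.univ fun j _ => hterm j

end IsSlowLabelling

end AdiabaticMap

section OrderedProd

variable {X : Type*} [NormedAddCommGroup X] [NormedSpace ℂ X] {M x : ℕ → X →L[ℂ] X} {T k : ℕ}

theorem norm_orderedProd_le {r : ℝ} (hM : ∀ n < T, ‖M (n + 1)‖ ≤ r) (hk : k ≤ T) :
    ‖orderedProd M k‖ ≤ r ^ k := by
  induction k with
  | zero => exact ContinuousLinearMap.norm_id_le
  | succ k ih =>
    rw [orderedProd, pow_succ']
    exact norm_mul_le_of_le (hM k hk) (ih (Nat.le_of_succ_le hk))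

theorem sub_orderedProd_succ_mul : x (k + 1) - orderedProd M (k + 1) * x 0 =
    M (k + 1) * (x k - orderedProd M k * x 0) + (x (k + 1) - M (k + 1) * x k) := by
  rw [orderedProd, mul_sub, mul_assoc]
  abel

theorem norm_sub_orderedProd_mul_le_sum {f : ℕ → ℝ} (hM : ∀ n < T, ‖M (n + 1)‖ ≤ 1)
    (hx : ∀ n < T, ‖x (n + 1) - M (n + 1) * x n‖ ≤ f n) (hk : k ≤ T) :
    ‖x k - orderedProd M k * x 0‖ ≤ ∑ n ∈ Finset.range k, f n := by
  induction k with
  | zero => simp [orderedProd]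
  | succ k ih =>
    rw [sub_orderedProd_succ_mul, Finset.sum_range_succ]
    refine norm_add_le_of_le ?_ (hx k hk)
    simpa only [one_mul] using norm_mul_le_of_le (hM k hk) (ih (Nat.le_of_succ_le hk))

theorem norm_sub_orderedProd_mul_le_div {r b : ℝ} (hM : ∀ n < T, ‖M (n + 1)‖ ≤ r) (hr : r < 1)
    (hb : 0 ≤ b) (hx : ∀ n < T, ‖x (n + 1) - M (n + 1) * x n‖ ≤ b) (hk : k ≤ T) :
    ‖x k - orderedProd M k * x 0‖ ≤ b / (1 - r) := by
  have hr' : 0 < 1 - r := sub_pos.2 hr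
  induction k with
  | zero =>
    rw [orderedProd, one_mul, sub_self, norm_zero]
    positivity
  | succ k ih =>
    calc ‖x (k + 1) - orderedProd M (k + 1) * x 0‖ ≤ r * (b / (1 - r)) + b := by
          rw [sub_orderedProd_succ_mul]
          exact norm_add_le_of_le (norm_mul_le_of_le (hM k hk) (ih (Nat.le_of_succ_le hk)))
            (hx k hk)
      _ = b / (1 - r) := by field_simp; ring

end OrderedProd

section SlowSplitting

variable {X : Type*} [NormedAddCommGroup X] [NormedSpace ℂ X] {A P : ℕ → X →L[ℂ] X} {T k : ℕ}
  {ℓ d : ℝ}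

/-- Contractions `A 0, …, A T` that commute with projections `P 0, …, P T` moving by at most `d` per
step, and whose restrictions to the kernels of these projections have norm at most `ℓ < 1`. -/
structure IsSlowSplitting (A P : ℕ → X →L[ℂ] X) (T : ℕ) (ℓ d : ℝ) : Prop where
  norm_le : ∀ k ≤ T, ‖A k‖ ≤ 1
  idem : ∀ k ≤ T, IsIdempotentElem (P k)
  commute : ∀ k ≤ T, Commute (A k) (P k)
  norm_proj_le : ∀ k ≤ T, ‖P k‖ ≤ 1
  norm_mul_compl_le : ∀ k ≤ T, ‖A k * (1 - P k)‖ ≤ ℓ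
  norm_sub_le : ∀ k < T, ‖P (k + 1) - P k‖ ≤ d
  nonneg : 0 ≤ d
  lt_one : ℓ < 1

namespace IsSlowSplitting

variable (h : IsSlowSplitting A P T ℓ d)
include h

theorem ratio_nonneg : 0 ≤ ℓ :=
  (norm_nonneg _).trans (h.norm_mul_compl_le 0 T.zero_le)

theorem norm_compl_le (hk : k ≤ T) : ‖1 - P k‖ ≤ 2 :=
  (norm_sub_le_of_le ContinuousLinearMap.norm_id_le (h.norm_proj_le k hk)).trans_eq
    one_add_one_eq_two

theorem norm_mul_proj_le (hk : k ≤ T) : ‖A k * P k‖ ≤ 1 :=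
  (norm_mul_le_of_le (h.norm_le k hk) (h.norm_proj_le k hk)).trans_eq (one_mul 1)

theorem norm_orderedProd_compl_le (hk : k ≤ T) :
    ‖orderedProd (fun n => A n * (1 - P n)) k‖ ≤ ℓ ^ k :=
  norm_orderedProd_le (fun n hn => h.norm_mul_compl_le (n + 1) hn) hk

theorem norm_orderedProd_mul_le (hk : k ≤ T) (V : X →L[ℂ] X) : ‖orderedProd A k * V‖ ≤ ‖V‖ := by
  have hA : ‖orderedProd A k‖ ≤ 1 ^ k := norm_orderedProd_le (fun n hn => h.norm_le (n + 1) hn) hk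
  simpa only [one_pow, one_mul] using norm_mul_le_of_le hA le_rfl

theorem norm_mul_compl_mul_proj_mul_le (hk : k < T) (V : X →L[ℂ] X) :
    ‖A (k + 1) * (1 - P (k + 1)) * (P k * V)‖ ≤ d * ‖V‖ := by
  have hcompl : (1 - P (k + 1)) * P k = (1 - P (k + 1)) * (P k - P (k + 1)) := by
    rw [mul_sub _ (P k), (h.idem _ hk).one_sub_mul_self, sub_zero]
  calc ‖A (k + 1) * (1 - P (k + 1)) * (P k * V)‖
      = ‖A (k + 1) * (1 - P (k + 1)) * (P k - P (k + 1)) * V‖ := by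
        rw [mul_assoc _ (1 - P (k + 1)) (P k - P (k + 1)), ← hcompl]
        simp only [mul_assoc]
    _ ≤ 1 * d * ‖V‖ := norm_mul_le_of_le (norm_mul_le_of_le
        ((h.norm_mul_compl_le _ hk).trans h.lt_one.le)
        ((norm_sub_rev _ _).trans_le (h.norm_sub_le k hk))) le_rfl
    _ = d * ‖V‖ := by rw [one_mul]

theorem norm_mul_proj_mul_compl_mul_le (hk : k < T) (V : X →L[ℂ] X) :
    ‖A (k + 1) * P (k + 1) * ((1 - P k) * V)‖ ≤ d * ‖(1 - P k) * V‖ := by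
  have hproj : P (k + 1) * ((1 - P k) * V) = (P (k + 1) - P k) * ((1 - P k) * V) := by
    rw [sub_mul _ _ ((1 - P k) * V), ← mul_assoc (P k), (h.idem _ hk.le).mul_one_sub_self,
      zero_mul, sub_zero]
  calc ‖A (k + 1) * P (k + 1) * ((1 - P k) * V)‖
      = ‖A (k + 1) * (P (k + 1) - P k) * ((1 - P k) * V)‖ := by rw [mul_assoc, hproj, mul_assoc]
    _ ≤ 1 * d * ‖(1 - P k) * V‖ :=
        norm_mul_le_of_le (norm_mul_le_of_le (h.norm_le _ hk) (h.norm_sub_le k hk)) le_rfl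
    _ = d * ‖(1 - P k) * V‖ := by rw [one_mul]

theorem proj_mul_orderedProd_succ_sub (hk : k < T) (V : X →L[ℂ] X) :
    P (k + 1) * (orderedProd A (k + 1) * V) -
      A (k + 1) * P (k + 1) * (P k * (orderedProd A k * V)) =
        A (k + 1) * P (k + 1) * ((1 - P k) * (orderedProd A k * V)) := by
  rw [sub_eq_iff_eq_add', ← mul_add, ← add_mul, add_sub_cancel, one_mul, orderedProd,
    (h.commute _ hk).eq]
  simp only [mul_assoc]

theorem compl_mul_orderedProd_succ_sub (hk : k < T) (V : X →L[ℂ] X) :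
    (1 - P (k + 1)) * (orderedProd A (k + 1) * V) -
      A (k + 1) * (1 - P (k + 1)) * ((1 - P k) * (orderedProd A k * V)) =
        A (k + 1) * (1 - P (k + 1)) * (P k * (orderedProd A k * V)) := by
  rw [sub_eq_iff_eq_add', ← mul_add, ← add_mul, sub_add_cancel, one_mul, orderedProd,
    ((Commute.one_right _).sub_right (h.commute _ hk)).eq]
  simp only [mul_assoc]

theorem norm_compl_mul_orderedProd_sub_le (hk : k ≤ T) (V : X →L[ℂ] X) :
    ‖(1 - P k) * (orderedProd A k * V) -
      orderedProd (fun n => A n * (1 - P n)) k * ((1 - P 0) * V)‖ ≤ d * ‖V‖ / (1 - ℓ) := by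
  refine norm_sub_orderedProd_mul_le_div (x := fun n => (1 - P n) * (orderedProd A n * V))
    (fun n hn => h.norm_mul_compl_le (n + 1) hn) h.lt_one
    (mul_nonneg h.nonneg (norm_nonneg V)) (fun n hn => ?_) hk
  rw [h.compl_mul_orderedProd_succ_sub hn]
  exact (h.norm_mul_compl_mul_proj_mul_le hn _).trans
    (mul_le_mul_of_nonneg_left (h.norm_orderedProd_mul_le hn.le V) h.nonneg)

theorem norm_compl_mul_orderedProd_le (hk : k ≤ T) (V : X →L[ℂ] X) :
    ‖(1 - P k) * (orderedProd A k * V)‖ ≤ (2 * ℓ ^ k + d / (1 - ℓ)) * ‖V‖ := by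
  have hstable : ‖orderedProd (fun n => A n * (1 - P n)) k * ((1 - P 0) * V)‖ ≤
      ℓ ^ k * (2 * ‖V‖) :=
    norm_mul_le_of_le (h.norm_orderedProd_compl_le hk)
      (norm_mul_le_of_le (h.norm_compl_le T.zero_le) le_rfl)
  refine (norm_le_norm_add_norm_sub' _ _).trans
    ((add_le_add hstable (h.norm_compl_mul_orderedProd_sub_le hk V)).trans_eq ?_)
  ring

theorem sum_norm_compl_mul_orderedProd_le (hk : k ≤ T) (V : X →L[ℂ] X) :
    ∑ n ∈ Finset.range k, ‖(1 - P n) * (orderedProd A n * V)‖ ≤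
      (2 + k * d) / (1 - ℓ) * ‖V‖ := by
  have hℓ : 0 < 1 - ℓ := sub_pos.2 h.lt_one
  have hgeom : ∑ n ∈ Finset.range k, ℓ ^ n ≤ 1 / (1 - ℓ) := by
    rw [geom_sum_eq h.lt_one.ne, ← neg_div_neg_eq, neg_sub, neg_sub]
    gcongr
    exact sub_le_self 1 (pow_nonneg h.ratio_nonneg k)
  calc ∑ n ∈ Finset.range k, ‖(1 - P n) * (orderedProd A n * V)‖
      ≤ ∑ n ∈ Finset.range k, (2 * ℓ ^ n + d / (1 - ℓ)) * ‖V‖ := Finset.sum_le_sum fun n hn =>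
        h.norm_compl_mul_orderedProd_le ((Finset.mem_range.1 hn).le.trans hk) V
    _ = (2 * ∑ n ∈ Finset.range k, ℓ ^ n + k * (d / (1 - ℓ))) * ‖V‖ := by
        rw [← Finset.sum_mul, Finset.sum_add_distrib, ← Finset.mul_sum, Finset.sum_const,
          Finset.card_range, nsmul_eq_mul]
    _ ≤ (2 * (1 / (1 - ℓ)) + k * (d / (1 - ℓ))) * ‖V‖ := by gcongr
    _ = (2 + k * d) / (1 - ℓ) * ‖V‖ := by ring

theorem norm_proj_mul_orderedProd_sub_le (hk : k ≤ T) (V : X →L[ℂ] X) :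
    ‖P k * (orderedProd A k * V) - orderedProd (fun n => A n * P n) k * (P 0 * V)‖ ≤
      d * ((2 + k * d) / (1 - ℓ) * ‖V‖) := by
  have hstep : ∀ n < T, ‖P (n + 1) * (orderedProd A (n + 1) * V) -
      A (n + 1) * P (n + 1) * (P n * (orderedProd A n * V))‖ ≤
        d * ‖(1 - P n) * (orderedProd A n * V)‖ := fun n hn => by
    rw [h.proj_mul_orderedProd_succ_sub hn]
    exact h.norm_mul_proj_mul_compl_mul_le hn _
  calc ‖P k * (orderedProd A k * V) - orderedProd (fun n => A n * P n) k * (P 0 * V)‖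
      ≤ ∑ n ∈ Finset.range k, d * ‖(1 - P n) * (orderedProd A n * V)‖ :=
        norm_sub_orderedProd_mul_le_sum (M := fun n => A n * P n)
          (x := fun n => P n * (orderedProd A n * V))
          (fun n hn => h.norm_mul_proj_le (k := n + 1) hn) hstep hk
    _ ≤ d * ((2 + k * d) / (1 - ℓ) * ‖V‖) := by
        rw [← Finset.mul_sum]
        exact mul_le_mul_of_nonneg_left (h.sum_norm_compl_mul_orderedProd_le hk V) h.nonneg

theorem norm_orderedProd_mul_sub_sub_le (hk : k ≤ T) (V : X →L[ℂ] X) :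
    ‖orderedProd A k * V - orderedProd (fun n => A n * P n) k * (P 0 * V) -
      orderedProd (fun n => A n * (1 - P n)) k * ((1 - P 0) * V)‖ ≤
        d * (3 + k * d) / (1 - ℓ) * ‖V‖ := by
  have hsplit : orderedProd A k * V =
      P k * (orderedProd A k * V) + (1 - P k) * (orderedProd A k * V) := by
    rw [← add_mul, add_sub_cancel, one_mul]
  rw [hsplit, sub_sub, add_sub_add_comm]
  refine (norm_add_le_of_le (h.norm_proj_mul_orderedProd_sub_le hk V)
    (h.norm_compl_mul_orderedProd_sub_le hk V)).trans_eq ?_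
  ring

end IsSlowSplitting

end SlowSplitting

section Corrector

variable {𝕜 R ι : Type*}

/-- The first order corrector `∑_j ∑_{i ≠ j} e_j / (e_i - e_j) p_j D_j p_i` of a family of
projections `p` with derivatives `D`; the diagonal terms vanish by the convention `x / 0 = 0`. -/
def corrector [Fintype ι] [Field 𝕜] [Ring R] [Algebra 𝕜 R] (e : ι → 𝕜) (p D : ι → R) : R :=
  ∑ j, ∑ i, (e j / (e i - e j)) • (p j * D j * p i)

section Algebra

variable [Fintype ι] [Field 𝕜] [Ring R] [Algebra 𝕜 R] {e : ι → 𝕜} {p D : ι → R}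

theorem sum_smul_mul_sum_proj (hp : OrthogonalIdempotents p) :
    (∑ j, e j • p j) * ∑ i, p i = ∑ j, e j • p j := by
  simpa only [Pi.one_apply, one_smul, mul_one] using sum_smul_mul_sum_smul hp e 1

theorem corrector_mul_sum_smul_sub (he : Function.Injective e) (hp : OrthogonalIdempotents p)
    (hD : ∀ i j, j ≠ i → p j * D i = -(D j * p i)) :
    corrector e p D * (∑ j, e j • p j) - (∑ j, e j • p j) * corrector e p D =
      -((∑ j, e j • p j) * ∑ i, (1 - p i) * D i) := by
  have hterm (j i : ι) : (e j / (e i - e j)) • (p j * D j * p i) * (∑ k, e k • p k) -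
      (∑ k, e k • p k) * (e j / (e i - e j)) • (p j * D j * p i) =
        -((e j • p j) * ((1 - p i) * D i)) := by
    have hright : p j * D j * p i * ∑ k, e k • p k = e i • (p j * D j * p i) := by
      rw [mul_assoc (p j * D j), proj_mul_sum_smul hp, mul_smul_comm]
    have hleft : (∑ k, e k • p k) * (p j * D j * p i) = e j • (p j * D j * p i) := by
      rw [mul_assoc (p j), ← mul_assoc _ (p j), sum_smul_mul_proj hp, smul_mul_assoc]
    rw [smul_mul_assoc, mul_smul_comm, hright, hleft, ← smul_sub, ← sub_smul, smul_smul]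
    rcases eq_or_ne j i with rfl | hji
    · rw [sub_self, mul_zero, zero_smul, smul_mul_assoc, ← mul_assoc,
        (hp.idem j).mul_one_sub_self, zero_mul, smul_zero, neg_zero]
    · rw [div_mul_cancel₀ _ (sub_ne_zero.2 (he.ne hji.symm)), mul_assoc,
        ← neg_eq_iff_eq_neg.2 (hD i j hji), mul_neg, ← mul_assoc, (hp.idem j).eq, sub_mul, one_mul,
        smul_mul_assoc, mul_sub, ← mul_assoc, hp.ortho hji, zero_mul, sub_zero, smul_neg]
  rw [Finset.sum_mul_sum]
  generalize ∑ k, e k • p k = M at hterm ⊢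
  simp only [corrector, Finset.sum_mul, Finset.mul_sum, ← Finset.sum_sub_distrib, hterm,
    Finset.sum_neg_distrib]

theorem sum_smul_mul_sub_add_smul_corrector (he : Function.Injective e)
    (hp : OrthogonalIdempotents p) (hD : ∀ i j, j ≠ i → p j * D i = -(D j * p i)) (q : ι → R)
    (h : 𝕜) :
    (∑ j, e j • p j) * (∑ i, p i * q i - ∑ i, q i) +
      h • (corrector e p D * (∑ j, e j • p j) - (∑ j, e j • p j) * corrector e p D) =
        (∑ j, e j • p j) * ∑ i, (1 - p i) * (p i - q i - h • D i) := by
  rw [corrector_mul_sum_smul_sub he hp hD, smul_neg, ← mul_smul_comm, ← sub_eq_add_neg, ← mul_sub,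
    Finset.smul_sum, ← Finset.sum_sub_distrib, ← Finset.sum_sub_distrib]
  congr 1
  refine Finset.sum_congr rfl fun i _ => ?_
  rw [mul_sub, mul_sub, (hp.idem i).one_sub_mul_self, zero_sub, sub_mul _ _ (q i), one_mul, neg_sub,
    mul_smul_comm]

theorem corrected_step_sub (he : Function.Injective e)
    (hp : OrthogonalIdempotents p) (hD : ∀ i j, j ≠ i → p j * D i = -(D j * p i)) (q : ι → R)
    (h : 𝕜) (κ Z' : R) :
    (1 + h • corrector e p D) * ((∑ j, e j • p j) * κ) -
      (∑ j, e j • p j) * (∑ i, q i + h • Z') =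
        (∑ j, e j • p j) * (κ - ∑ i, p i * q i) +
        (∑ j, e j • p j) * ∑ i, (1 - p i) * (p i - q i - h • D i) +
        h • (corrector e p D * (∑ j, e j • p j) * (κ - ∑ i, p i)) +
        h • ((∑ j, e j • p j) * (corrector e p D - Z')) := by
  rw [← sum_smul_mul_sub_add_smul_corrector he hp hD q h, mul_sub (corrector e p D * _),
    mul_assoc _ _ (∑ i, p i), sum_smul_mul_sum_proj hp]
  simp only [mul_sub, mul_add, add_mul, one_mul, smul_sub, smul_mul_assoc, mul_smul_comm, mul_assoc]
  abel

end Algebra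

section Norm

theorem norm_sum_le_card_mul [Fintype ι] {E : Type*} [SeminormedAddCommGroup E] {f : ι → E} {b : ℝ}
    (h : ∀ i, ‖f i‖ ≤ b) : ‖∑ i, f i‖ ≤ Fintype.card ι * b :=
  (norm_sum_le_of_le Finset.univ fun i _ => h i).trans_eq (by simp)

theorem norm_mul_mul_le_of_le [NonUnitalSeminormedRing R] {a b d : R} {x y z : ℝ} (ha : ‖a‖ ≤ x)
    (hb : ‖b‖ ≤ y) (hd : ‖d‖ ≤ z) : ‖a * b * d‖ ≤ x * y * z :=
  norm_mul_le_of_le (norm_mul_le_of_le ha hb) hd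

theorem norm_mul_mul_sub_le [NonUnitalSeminormedRing R] {a a' b b' d d' : R} {c δ : ℝ}
    (ha' : ‖a'‖ ≤ 1) (hb : ‖b‖ ≤ c) (hb' : ‖b'‖ ≤ c) (hd : ‖d‖ ≤ 1)
    (hsub : ‖a - a'‖ ≤ δ) (hsub' : ‖b - b'‖ ≤ δ) (hsub'' : ‖d - d'‖ ≤ δ) :
    ‖a * b * d - a' * b' * d'‖ ≤ (2 * c + 1) * δ := by
  have htelescope : a * b * d - a' * b' * d' =
      (a - a') * b * d + a' * (b - b') * d + a' * b' * (d - d') := by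
    noncomm_ring
  rw [htelescope]
  refine (norm_add₃_le.trans (add_le_add (add_le_add (norm_mul_mul_le_of_le hsub hb hd)
    (norm_mul_mul_le_of_le ha' hsub' hd)) (norm_mul_mul_le_of_le ha' hb' hsub''))).trans_eq ?_
  ring

variable [NormedField 𝕜] {e e' : ι → 𝕜} {c g δ z w : ℝ}

theorem norm_smul_le_of_le {E : Type*} [SeminormedAddCommGroup E] [NormedSpace 𝕜 E] {a : 𝕜} {v : E}
    {x y : ℝ} (ha : ‖a‖ ≤ x) (hv : ‖v‖ ≤ y) : ‖a • v‖ ≤ x * y := by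
  rw [norm_smul]
  exact mul_le_mul ha hv (norm_nonneg v) ((norm_nonneg a).trans ha)

theorem norm_div_sub_le (he : ∀ i, ‖e i‖ = 1) (hg : 0 < g)
    (hgap : ∀ i j, i ≠ j → g ≤ ‖e i - e j‖) (i j : ι) : ‖e j / (e i - e j)‖ ≤ g⁻¹ := by
  rcases eq_or_ne i j with rfl | hij
  · rw [sub_self, div_zero, norm_zero]
    positivity
  · rw [norm_div, he, one_div]
    exact inv_anti₀ hg (hgap i j hij)

theorem norm_div_sub_sub_le (he : ∀ i, ‖e i‖ = 1) (hg : 0 < g)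
    (hgap : ∀ i j, i ≠ j → g ≤ ‖e i - e j‖) (hgap' : ∀ i j, i ≠ j → g ≤ ‖e' i - e' j‖)
    (hsub : ∀ i, ‖e i - e' i‖ ≤ δ) (i j : ι) :
    ‖e j / (e i - e j) - e' j / (e' i - e' j)‖ ≤ 2 * g⁻¹ ^ 2 * δ := by
  rcases eq_or_ne i j with rfl | hij
  · have hδ : 0 ≤ δ := (norm_nonneg _).trans (hsub i)
    rw [sub_self, sub_self, div_zero, div_zero, sub_self, norm_zero]
    positivity
  have hne : e i - e j ≠ 0 := norm_pos_iff.1 (hg.trans_le (hgap i j hij))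
  have hne' : e' i - e' j ≠ 0 := norm_pos_iff.1 (hg.trans_le (hgap' i j hij))
  have hnum : ‖e i * (e j - e' j) - e j * (e i - e' i)‖ ≤ 1 * δ + 1 * δ :=
    norm_sub_le_of_le (norm_mul_le_of_le (he i).le (hsub j)) (norm_mul_le_of_le (he j).le (hsub i))
  calc ‖e j / (e i - e j) - e' j / (e' i - e' j)‖
      = ‖(e i * (e j - e' j) - e j * (e i - e' i)) * (e i - e j)⁻¹ * (e' i - e' j)⁻¹‖ := by
        congr 1
        field_simp
        ring
    _ ≤ (1 * δ + 1 * δ) * g⁻¹ * g⁻¹ := norm_mul_mul_le_of_le hnum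
        ((norm_inv _).trans_le (inv_anti₀ hg (hgap i j hij)))
        ((norm_inv _).trans_le (inv_anti₀ hg (hgap' i j hij)))
    _ = 2 * g⁻¹ ^ 2 * δ := by ring

variable [Fintype ι] [NormedRing R] [NormedAlgebra 𝕜 R] {p p' D D' : ι → R}

theorem norm_corrector_le (he : ∀ i, ‖e i‖ = 1) (hp : ∀ i, ‖p i‖ ≤ 1) (hD : ∀ i, ‖D i‖ ≤ c)
    (hg : 0 < g) (hgap : ∀ i j, i ≠ j → g ≤ ‖e i - e j‖) :
    ‖corrector e p D‖ ≤ Fintype.card ι * (Fintype.card ι * (g⁻¹ * c)) :=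
  norm_sum_le_card_mul fun j => norm_sum_le_card_mul fun i =>
    calc ‖(e j / (e i - e j)) • (p j * D j * p i)‖ ≤ g⁻¹ * (1 * c * 1) :=
          norm_smul_le_of_le (norm_div_sub_le he hg hgap i j)
            (norm_mul_mul_le_of_le (hp j) (hD j) (hp i))
      _ = g⁻¹ * c := by rw [one_mul, mul_one]

theorem norm_corrector_sub_le (he : ∀ i, ‖e i‖ = 1) (he' : ∀ i, ‖e' i‖ = 1)
    (hp : ∀ i, ‖p i‖ ≤ 1) (hp' : ∀ i, ‖p' i‖ ≤ 1) (hD : ∀ i, ‖D i‖ ≤ c) (hD' : ∀ i, ‖D' i‖ ≤ c)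
    (hg : 0 < g) (hgap : ∀ i j, i ≠ j → g ≤ ‖e i - e j‖)
    (hgap' : ∀ i j, i ≠ j → g ≤ ‖e' i - e' j‖) (hde : ∀ i, ‖e i - e' i‖ ≤ δ)
    (hdp : ∀ i, ‖p i - p' i‖ ≤ δ) (hdD : ∀ i, ‖D i - D' i‖ ≤ δ) :
    ‖corrector e p D - corrector e' p' D'‖ ≤
      Fintype.card ι * (Fintype.card ι * ((2 * g⁻¹ ^ 2 * c + g⁻¹ * (2 * c + 1)) * δ)) := by
  simp only [corrector, ← Finset.sum_sub_distrib]
  refine norm_sum_le_card_mul fun j => norm_sum_le_card_mul fun i => ?_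
  calc ‖(e j / (e i - e j)) • (p j * D j * p i) - (e' j / (e' i - e' j)) • (p' j * D' j * p' i)‖
      = ‖(e j / (e i - e j) - e' j / (e' i - e' j)) • (p j * D j * p i) +
          (e' j / (e' i - e' j)) • (p j * D j * p i - p' j * D' j * p' i)‖ := by
        rw [sub_smul, smul_sub, sub_add_sub_cancel]
    _ ≤ 2 * g⁻¹ ^ 2 * δ * (1 * c * 1) + g⁻¹ * ((2 * c + 1) * δ) := norm_add_le_of_le
        (norm_smul_le_of_le (norm_div_sub_sub_le he hg hgap hgap' hde i j)
          (norm_mul_mul_le_of_le (hp j) (hD j) (hp i)))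
        (norm_smul_le_of_le (norm_div_sub_le he' hg hgap' i j)
          (norm_mul_mul_sub_le (hp' j) (hD j) (hD' j) (hp i) (hdp j) (hdD j) (hdp i)))
    _ = (2 * g⁻¹ ^ 2 * c + g⁻¹ * (2 * c + 1)) * δ := by ring

/-- The corrector removes the first order part of the error made by transporting `∑ i, q i` along
`κ` instead of applying the evolution step `∑ j, e j • p j`. -/
theorem norm_corrected_step_sub_le (he : Function.Injective e) (hp : OrthogonalIdempotents p)
    (hpn : ∀ i, ‖p i‖ ≤ 1) (hM : ‖∑ j, e j • p j‖ ≤ 1)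
    (hD : ∀ i j, j ≠ i → p j * D i = -(D j * p i)) {q : ι → R} {κ Z' : R} {h : 𝕜}
    (hq : ∀ i, ‖p i - q i - h • D i‖ ≤ c * ‖h‖ ^ 2)
    (hκ : ‖κ - ∑ i, p i * q i‖ ≤ Fintype.card ι * (2 * (c * ‖h‖) ^ 2))
    (hκ' : ‖κ - ∑ i, p i‖ ≤ Fintype.card ι * (2 * (c * ‖h‖)))
    (hz : ‖corrector e p D‖ ≤ z) (hw : ‖corrector e p D - Z'‖ ≤ w * ‖h‖) :
    ‖(1 + h • corrector e p D) * ((∑ j, e j • p j) * κ) -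
      (∑ j, e j • p j) * (∑ i, q i + h • Z')‖ ≤
        (2 * Fintype.card ι * c ^ 2 + 2 * Fintype.card ι * c + 2 * z * Fintype.card ι * c + w) *
          ‖h‖ ^ 2 := by
  have hcompl (i : ι) : ‖(1 - p i) * (p i - q i - h • D i)‖ ≤ 2 * (c * ‖h‖ ^ 2) := by
    rw [sub_mul, one_mul]
    refine (norm_sub_le_of_le (hq i) (norm_mul_le_of_le (hpn i) (hq i))).trans_eq ?_
    ring
  rw [corrected_step_sub he hp hD]
  refine (norm_add₄_le.trans (add_le_add (add_le_add (add_le_add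
    (norm_mul_le_of_le hM hκ) (norm_mul_le_of_le hM (norm_sum_le_card_mul hcompl)))
    (norm_smul_le_of_le le_rfl (norm_mul_mul_le_of_le hz hM hκ')))
    (norm_smul_le_of_le le_rfl (norm_mul_le_of_le hM hw)))).trans_eq ?_
  ring

end Norm

end Corrector

section Constants

variable {c : ℝ} {N : ℕ} {ε : ℝ}

/-- The bound `N (1 - c² / T₀²) ^ (-T₀ / 2)` of the adiabatic maps, for `T₀ = 2 c + 1`. -/
def mapBound (c : ℝ) (N : ℕ) : ℝ :=
  N * (1 - c ^ 2 / (2 * c + 1) ^ 2) ^ (-(2 * c + 1) / 2)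

/-- The bound of the first order corrector given by a spectral gap `2 ε`. -/
def correctorBound (c : ℝ) (N : ℕ) (ε : ℝ) : ℝ :=
  N * (N * ((2 * ε)⁻¹ * c))

/-- The Lipschitz constant of the first order corrector given by a spectral gap `2 ε`. -/
def correctorLip (c : ℝ) (N : ℕ) (ε : ℝ) : ℝ :=
  N * (N * ((2 * (2 * ε)⁻¹ ^ 2 * c + (2 * ε)⁻¹ * (2 * c + 1)) * c))

/-- The constant of the second order error of one corrected step. -/
def defectBound (c : ℝ) (N : ℕ) (ε : ℝ) : ℝ :=
  2 * N * c ^ 2 + 2 * N * c + 2 * correctorBound c N ε * N * c + correctorLip c N ε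

/-- The constant of the leakage between the peripheral and the stable subspaces; the final `1` only
makes it positive. -/
def leakConst (c : ℝ) (N : ℕ) : ℝ :=
  2 * (3 * (N * c) + (N * c) ^ 2) + 1

/-- The constant of the approximation of the peripheral dynamics by the adiabatic maps. -/
def peripheralConst (c : ℝ) (N : ℕ) (ε : ℝ) : ℝ :=
  (2 * correctorBound c N ε + defectBound c N ε) * mapBound c N

/-- The constant of the adiabatic approximation. -/
def adiabaticConst (c : ℝ) (N : ℕ) (ε : ℝ) : ℝ :=
  leakConst c N + peripheralConst c N ε

theorem leakConst_pos (hc : 0 ≤ c) : 0 < leakConst c N := by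
  unfold leakConst
  positivity

theorem mapBound_nonneg (hc : 0 ≤ c) : 0 ≤ mapBound c N := by
  refine mul_nonneg N.cast_nonneg (Real.rpow_nonneg ?_ _)
  rw [← div_pow, sub_nonneg]
  exact pow_le_one₀ (by positivity) (div_le_one_of_le₀ (by linarith) (by linarith))

theorem defectBound_nonneg (hc : 0 ≤ c) (hε : 0 < ε) : 0 ≤ defectBound c N ε := by
  unfold defectBound correctorBound correctorLip
  positivity

theorem peripheralConst_nonneg (hc : 0 ≤ c) (hε : 0 < ε) : 0 ≤ peripheralConst c N ε := by
  have hz : 0 ≤ correctorBound c N ε := by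
    unfold correctorBound
    positivity
  have hd := defectBound_nonneg (N := N) hc hε
  exact mul_nonneg (by positivity) (mapBound_nonneg hc)

theorem adiabaticConst_pos (hc : 0 ≤ c) (hε : 0 < ε) : 0 < adiabaticConst c N ε :=
  add_pos_of_pos_of_nonneg (leakConst_pos hc) (peripheralConst_nonneg hc hε)

theorem two_mul_leak_le_leakConst_div {ℓ : ℝ} {k T : ℕ} (hc : 0 ≤ c) (hℓ : ℓ < 1) (hT : 0 < T)
    (hk : k ≤ T) :
    N * c / T * (3 + k * (N * c / T)) / (1 - ℓ) * 2 ≤ leakConst c N / (T * (1 - ℓ)) := by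
  have hℓ' : 0 < 1 - ℓ := sub_pos.2 hℓ
  have hkT : (k : ℝ) / T ≤ 1 := div_le_one_of_le₀ (by exact_mod_cast hk) T.cast_nonneg
  calc N * c / T * (3 + k * (N * c / T)) / (1 - ℓ) * 2
      = 2 * (3 * (N * c) + (k / T) * (N * c) ^ 2) / (T * (1 - ℓ)) := by field_simp
    _ ≤ 2 * (3 * (N * c) + 1 * (N * c) ^ 2) / (T * (1 - ℓ)) := by gcongr
    _ ≤ leakConst c N / (T * (1 - ℓ)) := by
        gcongr
        rw [one_mul]
        exact le_add_of_nonneg_right zero_le_one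

end Constants

section Discretisation

theorem natCast_div_mem_Icc {k T : ℕ} (hk : k ≤ T) : (k / T : ℝ) ∈ Icc (0 : ℝ) 1 :=
  ⟨by positivity, div_le_one_of_le₀ (by exact_mod_cast hk) T.cast_nonneg⟩

theorem succ_div_sub_div (k T : ℕ) : ((k + 1 : ℕ) / T : ℝ) - k / T = (T : ℝ)⁻¹ := by
  push_cast
  ring

theorem abs_succ_div_sub_div (k T : ℕ) : |((k + 1 : ℕ) / T : ℝ) - k / T| = (T : ℝ)⁻¹ := by
  rw [succ_div_sub_div, abs_of_nonneg (by positivity)]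

variable {X : Type*} [NormedAddCommGroup X] [NormedSpace ℂ X] {L : ℝ → X →L[ℂ] X} {ε ℓ c : ℝ}
  {N : ℕ} {e : Fin N → ℝ → ℂ} {T k : ℕ}

theorem IsLabelling.projAt_eq (he : IsLabelling L e) (hk : k ≤ T) :
    projAt L T k = ∑ j, eigProjAt L e T j k :=
  he.peripheralProj_eq (natCast_div_mem_Icc hk)

theorem DerivBound.norm_derivWithin_le (hb : DerivBound L e c) {s : ℝ} (hs : s ∈ Icc (0 : ℝ) 1)
    (j : Fin N) : ‖derivWithin (eigProj L e j) (Icc 0 1) s‖ ≤ c := by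
  rw [← iteratedDerivWithin_one]
  exact (hb s hs j 1 ⟨le_rfl, one_le_two⟩).1

theorem Hypotheses.two_mul_le_norm_eig_sub (h : Hypotheses L ε ℓ) (he : IsLabelling L e) {s : ℝ}
    (hs : s ∈ Icc (0 : ℝ) 1) (i j : Fin N) (hij : i ≠ j) : 2 * ε ≤ ‖e i s - e j s‖ := by
  have hmem (i : Fin N) : e i s ∈ peripheralSpectrum (L s) := he.range_eq s hs ▸ mem_range_self i
  exact (h.gap s hs _ (hmem i) _ (hmem j) ((he.injective s hs).ne hij)).le

variable [FiniteDimensional ℂ X]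

theorem Hypotheses.isPeripheralFamily_eigProjAt (h : Hypotheses L ε ℓ) (he : IsLabelling L e)
    (hk : k ≤ T) :
    IsPeripheralFamily (mapAt L T k) (fun j => e j (k / T : ℝ)) fun j => eigProjAt L e T j k :=
  h.isPeripheralFamily_eigProj he (natCast_div_mem_Icc hk)

theorem Hypotheses.mapAt_mul_projAt (h : Hypotheses L ε ℓ) (he : IsLabelling L e) (hk : k ≤ T) :
    mapAt L T k * projAt L T k = ∑ j, e j (k / T : ℝ) • eigProjAt L e T j k :=
  h.mul_peripheralProj_eq he (natCast_div_mem_Icc hk)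

theorem Hypotheses.norm_eig_succ_sub_le (h : Hypotheses L ε ℓ) (he : IsLabelling L e)
    (hb : DerivBound L e c) (hk : k < T) (j : Fin N) :
    ‖e j ((k + 1 : ℕ) / T : ℝ) - e j (k / T : ℝ)‖ ≤ c * (T : ℝ)⁻¹ := by
  rw [← abs_succ_div_sub_div k T]
  exact norm_sub_le_of_iteratedDerivWithin (convex_Icc 0 1)
    ((h.contDiffOn_eig he j).differentiableOn two_ne_zero)
    (fun s hs => (hb s hs j 1 ⟨le_rfl, one_le_two⟩).2) (natCast_div_mem_Icc hk.le)
    (natCast_div_mem_Icc hk)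

theorem Hypotheses.norm_eigProjAt_succ_sub_le (h : Hypotheses L ε ℓ) (he : IsLabelling L e)
    (hb : DerivBound L e c) (hk : k < T) (j : Fin N) :
    ‖eigProjAt L e T j (k + 1) - eigProjAt L e T j k‖ ≤ c * (T : ℝ)⁻¹ := by
  rw [← abs_succ_div_sub_div k T]
  exact norm_sub_le_of_iteratedDerivWithin (convex_Icc 0 1)
    ((h.contDiffOn_eigProj he j).differentiableOn two_ne_zero)
    (fun s hs => (hb s hs j 1 ⟨le_rfl, one_le_two⟩).1) (natCast_div_mem_Icc hk.le)
    (natCast_div_mem_Icc hk)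

theorem Hypotheses.norm_derivWithin_eigProj_succ_sub_le (h : Hypotheses L ε ℓ)
    (he : IsLabelling L e) (hb : DerivBound L e c) (hk : k < T) (j : Fin N) :
    ‖derivWithin (eigProj L e j) (Icc 0 1) ((k + 1 : ℕ) / T : ℝ) -
      derivWithin (eigProj L e j) (Icc 0 1) (k / T : ℝ)‖ ≤ c * (T : ℝ)⁻¹ := by
  rw [← abs_succ_div_sub_div k T]
  exact norm_derivWithin_sub_le_of_iteratedDerivWithin (convex_Icc 0 1) uniqueDiffOn_Icc_zero_one
    (h.contDiffOn_eigProj he j) (fun s hs => (hb s hs j 2 ⟨one_le_two, le_rfl⟩).1)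
    (natCast_div_mem_Icc hk.le) (natCast_div_mem_Icc hk)

theorem Hypotheses.norm_eigProjAt_succ_sub_sub_le (h : Hypotheses L ε ℓ) (he : IsLabelling L e)
    (hb : DerivBound L e c) (hk : k < T) (j : Fin N) :
    ‖eigProjAt L e T j (k + 1) - eigProjAt L e T j k -
      (T : ℂ)⁻¹ • derivWithin (eigProj L e j) (Icc 0 1) ((k + 1 : ℕ) / T : ℝ)‖ ≤
        c * (T : ℝ)⁻¹ ^ 2 := by
  have htaylor := norm_sub_sub_smul_derivWithin_le (convex_Icc 0 1) uniqueDiffOn_Icc_zero_one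
    (h.contDiffOn_eigProj he j) (fun s hs => (hb s hs j 2 ⟨one_le_two, le_rfl⟩).1)
    (natCast_div_mem_Icc hk.le) (natCast_div_mem_Icc hk)
  rw [abs_succ_div_sub_div, succ_div_sub_div, ← Complex.coe_smul, Complex.ofReal_inv,
    Complex.ofReal_natCast] at htaylor
  exact htaylor

theorem Hypotheses.isSlowLabelling (h : Hypotheses L ε ℓ) (he : IsLabelling L e)
    (hb : DerivBound L e c) (hcT : c / T < 1) : IsSlowLabelling L e T (c / T) where
  orthogonal _ hk := (h.isPeripheralFamily_eigProjAt he hk).orthogonal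
  norm_le_one _ hk := (h.isPeripheralFamily_eigProjAt he hk).norm_le_one
  norm_eig _ hk := (h.isPeripheralFamily_eigProjAt he hk).norm_eig
  norm_sub_le _ hk := h.norm_eigProjAt_succ_sub_le he hb hk
  lt_one := hcT

theorem Hypotheses.isSlowSplitting (h : Hypotheses L ε ℓ) (he : IsLabelling L e) (hc : 0 ≤ c)
    (hb : DerivBound L e c) : IsSlowSplitting (mapAt L T) (projAt L T) T ℓ (N * c / T) where
  norm_le _ hk := h.contraction _ (natCast_div_mem_Icc hk)
  idem k hk := by
    rw [he.projAt_eq hk]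
    exact (h.isPeripheralFamily_eigProjAt he hk).orthogonal.isIdempotentElem_sum
  commute k hk := by
    have hfam := h.isPeripheralFamily_eigProjAt he hk
    rw [he.projAt_eq hk]
    exact Commute.sum_right _ _ _ fun j _ => (hfam.mul_left j).trans (hfam.mul_right j).symm
  norm_proj_le k hk := by
    rw [he.projAt_eq hk]
    exact (h.isPeripheralFamily_eigProjAt he hk).norm_sum_le
  norm_mul_compl_le _ hk := h.norm_mul_stableProj_le (natCast_div_mem_Icc hk)
  norm_sub_le k hk := by
    rw [he.projAt_eq hk, he.projAt_eq hk.le, ← Finset.sum_sub_distrib, mul_div_assoc]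
    exact (norm_sum_le_card_mul (h.norm_eigProjAt_succ_sub_le he hb hk)).trans_eq
      (by rw [Fintype.card_fin, div_eq_mul_inv])
  nonneg := by positivity
  lt_one := h.lt_one

end Discretisation

section PeripheralDynamics

variable {X : Type*} [NormedAddCommGroup X] [NormedSpace ℂ X] {L : ℝ → X →L[ℂ] X} {ε ℓ c : ℝ}
  {N : ℕ} {e : Fin N → ℝ → ℂ} {T k : ℕ}

/-- The first order corrector of the spectral projections at time `k / T`. -/
def correctorAt (L : ℝ → X →L[ℂ] X) (e : Fin N → ℝ → ℂ) (T k : ℕ) : X →L[ℂ] X :=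
  corrector (fun j => e j (k / T : ℝ)) (fun j => eigProjAt L e T j k)
    fun j => derivWithin (eigProj L e j) (Icc 0 1) (k / T : ℝ)

/-- The adiabatic map multiplied by `1 + T⁻¹ Z_k`, with `Z_k` the first order corrector. -/
def correctedMap (L : ℝ → X →L[ℂ] X) (e : Fin N → ℝ → ℂ) (T k : ℕ) : X →L[ℂ] X :=
  (1 + (T : ℂ)⁻¹ • correctorAt L e T k) * adiabaticMap L e T k

theorem adiabaticMap_zero : adiabaticMap L e T 0 = ∑ j, eigProjAt L e T j 0 := by
  simp [adiabaticMap, orderedProd, phase]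

variable [FiniteDimensional ℂ X]

theorem Hypotheses.norm_correctorAt_le (h : Hypotheses L ε ℓ) (he : IsLabelling L e)
    (hb : DerivBound L e c) (hk : k ≤ T) : ‖correctorAt L e T k‖ ≤ correctorBound c N ε := by
  have hfam := h.isPeripheralFamily_eigProjAt he hk
  have hs := natCast_div_mem_Icc hk
  exact (norm_corrector_le hfam.norm_eig hfam.norm_le_one (hb.norm_derivWithin_le hs)
    (mul_pos two_pos h.gap_pos) (h.two_mul_le_norm_eig_sub he hs)).trans_eq
    (by rw [Fintype.card_fin, correctorBound])

theorem Hypotheses.norm_correctorAt_succ_sub_le (h : Hypotheses L ε ℓ) (he : IsLabelling L e)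
    (hb : DerivBound L e c) (hk : k < T) :
    ‖correctorAt L e T (k + 1) - correctorAt L e T k‖ ≤ correctorLip c N ε * (T : ℝ)⁻¹ := by
  have hfam := h.isPeripheralFamily_eigProjAt he hk.le
  have hfam' := h.isPeripheralFamily_eigProjAt he (Nat.succ_le_of_lt hk)
  have hs := natCast_div_mem_Icc hk.le
  have ht := natCast_div_mem_Icc (Nat.succ_le_of_lt hk)
  refine (norm_corrector_sub_le hfam'.norm_eig hfam.norm_eig hfam'.norm_le_one hfam.norm_le_one
    (hb.norm_derivWithin_le ht) (hb.norm_derivWithin_le hs) (mul_pos two_pos h.gap_pos)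
    (h.two_mul_le_norm_eig_sub he ht) (h.two_mul_le_norm_eig_sub he hs)
    (h.norm_eig_succ_sub_le he hb hk) (h.norm_eigProjAt_succ_sub_le he hb hk)
    (h.norm_derivWithin_eigProj_succ_sub_le he hb hk)).trans_eq ?_
  rw [Fintype.card_fin, correctorLip]
  ring

theorem Hypotheses.norm_katoStep_sub_le (h : Hypotheses L ε ℓ) (he : IsLabelling L e)
    (hb : DerivBound L e c) (hcT : c * (T : ℝ)⁻¹ ≤ 1 / 2) (hk : k < T) :
    ‖katoStep L e T (k + 1) - ∑ j, eigProjAt L e T j (k + 1) * eigProjAt L e T j k‖ ≤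
      Fintype.card (Fin N) * (2 * (c * (T : ℝ)⁻¹) ^ 2) := by
  rw [katoStep_succ, ← Finset.sum_sub_distrib]
  exact norm_sum_le_card_mul fun j =>
    norm_katoTerm_sub_le ((h.isPeripheralFamily_eigProjAt he hk).norm_le_one j)
      ((h.isPeripheralFamily_eigProjAt he hk.le).norm_le_one j)
      (h.norm_eigProjAt_succ_sub_le he hb hk j) hcT

theorem Hypotheses.norm_katoStep_sub_sum_le (h : Hypotheses L ε ℓ) (he : IsLabelling L e)
    (hb : DerivBound L e c) (hcT : c * (T : ℝ)⁻¹ ≤ 1 / 2) (hk : k < T) :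
    ‖katoStep L e T (k + 1) - ∑ j, eigProjAt L e T j (k + 1)‖ ≤
      Fintype.card (Fin N) * (2 * (c * (T : ℝ)⁻¹)) := by
  have : CompleteSpace X := FiniteDimensional.complete ℂ X
  have hfam := h.isPeripheralFamily_eigProjAt he (Nat.succ_le_of_lt hk)
  rw [katoStep_succ, ← Finset.sum_sub_distrib]
  exact norm_sum_le_card_mul fun j =>
    norm_katoTerm_sub_left_le (hfam.norm_le_one j) (hfam.orthogonal.idem j)
      ((h.isPeripheralFamily_eigProjAt he hk.le).norm_le_one j)
      (h.norm_eigProjAt_succ_sub_le he hb hk j) hcT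

theorem Hypotheses.norm_correctedMap_succ_sub_le (h : Hypotheses L ε ℓ) (he : IsLabelling L e)
    (hc : 0 ≤ c) (hb : DerivBound L e c) (hcT : c * (T : ℝ)⁻¹ ≤ 1 / 2) (hk : k < T) :
    ‖correctedMap L e T (k + 1) - mapAt L T (k + 1) * projAt L T (k + 1) * correctedMap L e T k‖ ≤
      defectBound c N ε * (T : ℝ)⁻¹ ^ 2 * ‖adiabaticMap L e T k‖ := by
  have : CompleteSpace X := FiniteDimensional.complete ℂ X
  have hslow := h.isSlowLabelling he hb (lt_of_le_of_lt hcT one_half_lt_one)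
  have ht := natCast_div_mem_Icc (Nat.succ_le_of_lt hk)
  have hfam := h.isPeripheralFamily_eigProjAt he (Nat.succ_le_of_lt hk)
  have hnorm : ‖(T : ℂ)⁻¹‖ = (T : ℝ)⁻¹ := by rw [norm_inv, Complex.norm_natCast]
  have hM : ‖∑ j, e j ((k + 1 : ℕ) / T : ℝ) • eigProjAt L e T j (k + 1)‖ ≤ 1 := by
    rw [← h.mapAt_mul_projAt he (Nat.succ_le_of_lt hk)]
    exact (h.isSlowSplitting he hc hb).norm_mul_proj_le hk
  have hstep := norm_corrected_step_sub_le (h := (T : ℂ)⁻¹) (he.injective _ ht) hfam.orthogonal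
    hfam.norm_le_one hM (fun i j hij => h.eigProj_mul_derivWithin_eigProj he hij ht)
    (by simpa only [hnorm] using h.norm_eigProjAt_succ_sub_sub_le he hb hk)
    (by simpa only [hnorm] using h.norm_katoStep_sub_le he hb hcT hk)
    (by simpa only [hnorm] using h.norm_katoStep_sub_sum_le he hb hcT hk)
    (h.norm_correctorAt_le he hb hk)
    (by rw [hnorm]; exact h.norm_correctorAt_succ_sub_le he hb hk)
  rw [hnorm, Fintype.card_fin] at hstep
  have hfactor : correctedMap L e T k =
      (∑ i, eigProjAt L e T i k + (T : ℂ)⁻¹ • correctorAt L e T k) * adiabaticMap L e T k := by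
    rw [correctedMap, add_mul, add_mul, one_mul,
      (hslow.isFamilyEquiv_adiabaticMap hk.le).target_map]
  rw [hfactor, correctedMap, hslow.adiabaticMap_succ hk, h.mapAt_mul_projAt he hk, ← mul_assoc _ _
    (adiabaticMap L e T k), ← mul_assoc _ _ (adiabaticMap L e T k), ← mul_assoc _ _
    (adiabaticMap L e T k), ← sub_mul]
  exact norm_mul_le_of_le hstep le_rfl

theorem Hypotheses.max_norm_adiabaticMap_le (h : Hypotheses L ε ℓ) (he : IsLabelling L e)
    (hc : 0 ≤ c) (hb : DerivBound L e c) (hT : 2 * c + 1 ≤ T) (hk : k ≤ T) :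
    max ‖adiabaticMap L e T k‖ ‖adiabaticMapDagger L e T k‖ ≤ mapBound c N := by
  have : CompleteSpace X := FiniteDimensional.complete ℂ X
  have hslow := h.isSlowLabelling he hb (by rw [div_lt_one] <;> linarith)
  exact (max_le (hslow.norm_adiabaticMap_le hk) (hslow.norm_adiabaticMapDagger_le hk)).trans
    (mul_le_mul_of_nonneg_left (rpow_one_sub_sq_div_pow_le
      (by rw [abs_of_nonneg hc]; linarith) hT hk) N.cast_nonneg)

theorem Hypotheses.norm_correctedMap_sub_le (h : Hypotheses L ε ℓ) (he : IsLabelling L e)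
    (hc : 0 ≤ c) (hb : DerivBound L e c) (hT : 2 * c + 1 ≤ T) (hk : k ≤ T) :
    ‖correctedMap L e T k - evolutionP L T k * correctedMap L e T 0‖ ≤
      (T : ℝ)⁻¹ * (defectBound c N ε * mapBound c N) := by
  have hT' : (0 : ℝ) < T := by linarith
  have hcT : c * (T : ℝ)⁻¹ ≤ 1 / 2 := by rw [mul_inv_le_iff₀ hT']; linarith
  have hd := defectBound_nonneg (N := N) hc h.gap_pos
  have hB := mapBound_nonneg (N := N) hc
  have hsum := norm_sub_orderedProd_mul_le_sum (M := fun n => mapAt L T n * projAt L T n)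
    (x := correctedMap L e T)
    (f := fun _ => defectBound c N ε * (T : ℝ)⁻¹ ^ 2 * mapBound c N)
    (fun n hn => (h.isSlowSplitting he hc hb).norm_mul_proj_le (k := n + 1) hn)
    (fun n hn => (h.norm_correctedMap_succ_sub_le he hc hb hcT hn).trans
      (mul_le_mul_of_nonneg_left ((le_max_left _ _).trans
        (h.max_norm_adiabaticMap_le he hc hb hT hn.le)) (by positivity))) hk
  rw [Finset.sum_const, Finset.card_range, nsmul_eq_mul] at hsum
  calc ‖correctedMap L e T k - evolutionP L T k * correctedMap L e T 0‖
      ≤ k * (defectBound c N ε * (T : ℝ)⁻¹ ^ 2 * mapBound c N) := hsum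
    _ ≤ T * (defectBound c N ε * (T : ℝ)⁻¹ ^ 2 * mapBound c N) := by gcongr
    _ = (T : ℝ)⁻¹ * (defectBound c N ε * mapBound c N) := by field_simp

theorem Hypotheses.norm_evolutionP_sub_le (h : Hypotheses L ε ℓ) (he : IsLabelling L e)
    (hc : 0 ≤ c) (hb : DerivBound L e c) (hT : 2 * c + 1 ≤ T) (hk : k ≤ T) :
    ‖evolutionP L T k * projAt L T 0 - adiabaticMap L e T k‖ ≤ peripheralConst c N ε / T := by
  have hcorr {n : ℕ} (hn : n ≤ T) : ‖(T : ℂ)⁻¹ • (correctorAt L e T n * adiabaticMap L e T n)‖ ≤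
      (T : ℝ)⁻¹ * (correctorBound c N ε * mapBound c N) :=
    norm_smul_le_of_le (by rw [norm_inv, Complex.norm_natCast])
      (norm_mul_le_of_le (h.norm_correctorAt_le he hb hn)
        ((le_max_left _ _).trans (h.max_norm_adiabaticMap_le he hc hb hT hn)))
  have hevol : ‖evolutionP L T k‖ ≤ 1 ^ k := norm_orderedProd_le
    (fun n hn => (h.isSlowSplitting he hc hb).norm_mul_proj_le (k := n + 1) hn) hk
  have hdecomp : evolutionP L T k * projAt L T 0 - adiabaticMap L e T k =
      (T : ℂ)⁻¹ • (correctorAt L e T k * adiabaticMap L e T k) -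
        evolutionP L T k * (T : ℂ)⁻¹ • (correctorAt L e T 0 * adiabaticMap L e T 0) -
        (correctedMap L e T k - evolutionP L T k * correctedMap L e T 0) := by
    rw [he.projAt_eq T.zero_le, ← adiabaticMap_zero]
    simp only [correctedMap, add_mul, one_mul, mul_add, smul_mul_assoc]
    abel
  rw [hdecomp]
  refine (norm_sub_le_of_le (norm_sub_le_of_le (hcorr hk)
    (norm_mul_le_of_le hevol (hcorr T.zero_le)))
    (h.norm_correctedMap_sub_le he hc hb hT hk)).trans_eq ?_
  rw [peripheralConst]
  ring

end PeripheralDynamics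

section AdiabaticTheorem

variable {X : Type*} [NormedAddCommGroup X] [NormedSpace ℂ X] {L : ℝ → X →L[ℂ] X} {ε ℓ c : ℝ}
  {N : ℕ} {e : Fin N → ℝ → ℂ} {T k : ℕ}

theorem IsFamilyEquiv.map_mul_stableAt (he : IsLabelling L e) {q : Fin N → X →L[ℂ] X}
    {U V : X →L[ℂ] X} (hU : IsFamilyEquiv (fun j => eigProjAt L e T j 0) q U V) :
    U * stableAt L T 0 = 0 := by
  change U * (1 - projAt L T 0) = 0
  rw [he.projAt_eq T.zero_le, mul_sub, mul_one, hU.map_source, sub_self]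

theorem IsFamilyEquiv.stableAt_mul_inv (he : IsLabelling L e) {q : Fin N → X →L[ℂ] X}
    {U V : X →L[ℂ] X} (hU : IsFamilyEquiv (fun j => eigProjAt L e T j 0) q U V) :
    stableAt L T 0 * V = 0 := by
  change (1 - projAt L T 0) * V = 0
  rw [he.projAt_eq T.zero_le, sub_mul, one_mul, hU.source_inv, sub_self]

variable [FiniteDimensional ℂ X]

theorem Hypotheses.norm_evolution_mul_sub_sub_le (h : Hypotheses L ε ℓ) (he : IsLabelling L e)
    (hc : 0 ≤ c) (hb : DerivBound L e c) (hT : 0 < T) (hk : k ≤ T) {V : X →L[ℂ] X}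
    (hV : ‖V‖ ≤ 2) :
    ‖evolution L T k * V - evolutionP L T k * (projAt L T 0 * V) -
      evolutionQ L T k * (stableAt L T 0 * V)‖ ≤ leakConst c N / (T * (1 - ℓ)) := by
  have hℓ : 0 < 1 - ℓ := sub_pos.2 h.lt_one
  exact ((h.isSlowSplitting he hc hb).norm_orderedProd_mul_sub_sub_le hk V).trans
    ((mul_le_mul_of_nonneg_left hV (by positivity)).trans
      (two_mul_leak_le_leakConst_div hc h.lt_one hT hk))

theorem Hypotheses.norm_evolution_sub_sub_le (h : Hypotheses L ε ℓ) (he : IsLabelling L e)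
    (hc : 0 ≤ c) (hb : DerivBound L e c) (hT : 0 < T) (hk : k ≤ T) :
    ‖evolution L T k - evolutionP L T k * projAt L T 0 - evolutionQ L T k * stableAt L T 0‖ ≤
      leakConst c N / (T * (1 - ℓ)) := by
  simpa only [mul_one] using h.norm_evolution_mul_sub_sub_le he hc hb hT hk (V := 1)
    (ContinuousLinearMap.norm_id_le.trans one_le_two)

theorem Hypotheses.norm_evolution_mul_projAt_sub_le (h : Hypotheses L ε ℓ) (he : IsLabelling L e)
    (hc : 0 ≤ c) (hb : DerivBound L e c) (hT : 0 < T) (hk : k ≤ T) :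
    ‖evolution L T k * projAt L T 0 - evolutionP L T k * projAt L T 0‖ ≤
      leakConst c N / (T * (1 - ℓ)) := by
  have hsplit := h.isSlowSplitting (T := T) he hc hb
  have hidem := hsplit.idem 0 T.zero_le
  have hcompl : stableAt L T 0 * projAt L T 0 = 0 := hidem.one_sub_mul_self
  simpa only [hidem.eq, hcompl, mul_zero, sub_zero] using
    h.norm_evolution_mul_sub_sub_le he hc hb hT hk
      ((hsplit.norm_proj_le 0 T.zero_le).trans one_le_two)

theorem Hypotheses.norm_evolutionQ_mul_stableAt_le (h : Hypotheses L ε ℓ) (he : IsLabelling L e)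
    (hc : 0 ≤ c) (hb : DerivBound L e c) (hk : k ≤ T) :
    ‖evolutionQ L T k * stableAt L T 0‖ ≤ 2 * ℓ ^ k := by
  have hsplit := h.isSlowSplitting (T := T) he hc hb
  exact (norm_mul_le_of_le (hsplit.norm_orderedProd_compl_le hk)
    (hsplit.norm_compl_le T.zero_le)).trans_eq (mul_comm _ _)

theorem Hypotheses.norm_evolution_mul_stableAt_le (h : Hypotheses L ε ℓ) (he : IsLabelling L e)
    (hc : 0 ≤ c) (hb : DerivBound L e c) (hT : 0 < T) (hk : k ≤ T) :
    ‖evolution L T k * stableAt L T 0‖ ≤ leakConst c N / (T * (1 - ℓ)) + 2 * ℓ ^ k := by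
  have hsplit := h.isSlowSplitting (T := T) he hc hb
  have hidem := hsplit.idem 0 T.zero_le
  have hproj : projAt L T 0 * stableAt L T 0 = 0 := hidem.mul_one_sub_self
  have hstable : stableAt L T 0 * stableAt L T 0 = stableAt L T 0 := hidem.one_sub.eq
  have hleak := h.norm_evolution_mul_sub_sub_le he hc hb hT hk (hsplit.norm_compl_le T.zero_le)
  change ‖_ * stableAt L T 0 - _ * (_ * stableAt L T 0) - _ * (_ * stableAt L T 0)‖ ≤ _ at hleak
  rw [hproj, hstable, mul_zero, sub_zero] at hleak
  exact (norm_le_norm_sub_add _ _).trans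
    (add_le_add hleak (h.norm_evolutionQ_mul_stableAt_le he hc hb hk))

theorem Hypotheses.norm_evolutionP_sub_le_adiabaticConst (h : Hypotheses L ε ℓ)
    (he : IsLabelling L e) (hc : 0 ≤ c) (hb : DerivBound L e c) (hT : 2 * c + 1 ≤ T)
    (hk : k ≤ T) :
    ‖evolutionP L T k * projAt L T 0 - adiabaticMap L e T k‖ ≤ adiabaticConst c N ε / T :=
  (h.norm_evolutionP_sub_le he hc hb hT hk).trans (div_le_div_of_nonneg_right
    (le_add_of_nonneg_left (leakConst_pos hc).le) T.cast_nonneg)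

theorem Hypotheses.norm_evolution_sub_adiabaticMap_le (h : Hypotheses L ε ℓ)
    (he : IsLabelling L e) (hc : 0 ≤ c) (hb : DerivBound L e c) (hT : 2 * c + 1 ≤ T)
    (hk : k ≤ T) :
    ‖evolution L T k - adiabaticMap L e T k‖ ≤
      adiabaticConst c N ε / (T * (1 - ℓ)) + 2 * ℓ ^ k := by
  have hT' : (0 : ℝ) < T := by linarith
  have hℓ : 0 < 1 - ℓ := sub_pos.2 h.lt_one
  have hℓ' : 1 - ℓ ≤ 1 := sub_le_self 1 (h.isSlowSplitting (T := T) he hc hb).ratio_nonneg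
  have hperipheral : ‖evolutionP L T k * projAt L T 0 - adiabaticMap L e T k‖ ≤
      peripheralConst c N ε / (T * (1 - ℓ)) :=
    (h.norm_evolutionP_sub_le he hc hb hT hk).trans (div_le_div_of_nonneg_left
      (peripheralConst_nonneg hc h.gap_pos) (by positivity) (mul_le_of_le_one_right hT'.le hℓ'))
  have hdecomp : evolution L T k - adiabaticMap L e T k =
      (evolution L T k - evolutionP L T k * projAt L T 0 - evolutionQ L T k * stableAt L T 0) +
        (evolutionP L T k * projAt L T 0 - adiabaticMap L e T k) +
        evolutionQ L T k * stableAt L T 0 := by abel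
  rw [hdecomp, adiabaticConst, add_div]
  exact norm_add_le_of_le (norm_add_le_of_le
    (h.norm_evolution_sub_sub_le he hc hb (by exact_mod_cast hT') hk) hperipheral)
    (h.norm_evolutionQ_mul_stableAt_le he hc hb hk)

end AdiabaticTheorem

end Adiabatic

end

theorem theorem4p5 :
    ∃ (T₀ : ℝ → ℕ → ℝ) (C₀ : ℝ → ℕ → ℝ) (C : ℝ → ℕ → ℝ → ℝ),
      (∀ c N, 0 ≤ c → 0 < T₀ c N ∧ c < T₀ c N ∧ 0 < C₀ c N) ∧
      (∀ c N ε, 0 ≤ c → 0 < ε → 0 < C c N ε) ∧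
      ∀ (X : Type*) [NormedAddCommGroup X] [NormedSpace ℂ X] [FiniteDimensional ℂ X]
        (L : ℝ → X →L[ℂ] X) (ε ℓ : ℝ), Adiabatic.Hypotheses L ε ℓ →
        (∃ e : Fin (Adiabatic.maxCount L) → ℝ → ℂ, Adiabatic.IsLabelling L e) ∧
        ∀ e : Fin (Adiabatic.maxCount L) → ℝ → ℂ, Adiabatic.IsLabelling L e →
          (∀ j, ContDiffOn ℝ 2 (e j) (Set.Icc 0 1) ∧
            ContDiffOn ℝ 2 (Adiabatic.eigProj L e j) (Set.Icc 0 1)) ∧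
          (∃ c, 0 ≤ c ∧ Adiabatic.DerivBound L e c) ∧
          ∀ c, 0 ≤ c → Adiabatic.DerivBound L e c →
          ∀ T : ℕ, T₀ c (Adiabatic.maxCount L) ≤ T →
            -- the Kato maps are well defined
            (∀ k < T, ∀ j,
              ‖Adiabatic.eigProjAt L e T j (k + 1) - Adiabatic.eigProjAt L e T j k‖ < 1) ∧
            ∀ k ≤ T,
              -- uniform bounds
              max ‖Adiabatic.adiabaticMap L e T k‖ ‖Adiabatic.adiabaticMapDagger L e T k‖ ≤
                Adiabatic.maxCount L *
                  (1 - c ^ 2 / T₀ c (Adiabatic.maxCount L) ^ 2) ^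
                    (-(T₀ c (Adiabatic.maxCount L)) / 2) ∧
              -- pseudo-inverse and intertwining relations
              Adiabatic.adiabaticMapDagger L e T k * Adiabatic.adiabaticMap L e T k =
                Adiabatic.projAt L T 0 ∧
              Adiabatic.adiabaticMap L e T k * Adiabatic.adiabaticMapDagger L e T k =
                Adiabatic.projAt L T k ∧
              (∀ j, Adiabatic.adiabaticMap L e T k * Adiabatic.eigProjAt L e T j 0 =
                Adiabatic.eigProjAt L e T j k * Adiabatic.adiabaticMap L e T k) ∧
              (∀ j, Adiabatic.adiabaticMapDagger L e T k * Adiabatic.eigProjAt L e T j k =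
                Adiabatic.eigProjAt L e T j 0 * Adiabatic.adiabaticMapDagger L e T k) ∧
              Adiabatic.adiabaticMap L e T k * Adiabatic.stableAt L T 0 = 0 ∧
              Adiabatic.stableAt L T 0 * Adiabatic.adiabaticMapDagger L e T k = 0 ∧
              -- the adiabatic approximation
              ‖Adiabatic.evolution L T k - Adiabatic.adiabaticMap L e T k‖ ≤
                C c (Adiabatic.maxCount L) ε / (T * (1 - ℓ)) + 2 * ℓ ^ k ∧
              -- approximation of the peripheral dynamics
              ‖Adiabatic.evolutionP L T k * Adiabatic.projAt L T 0 -
                  Adiabatic.adiabaticMap L e T k‖ ≤ C c (Adiabatic.maxCount L) ε / T ∧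
              -- the strictly contracting parts are negligible
              ‖Adiabatic.evolution L T k -
                  Adiabatic.evolutionP L T k * Adiabatic.projAt L T 0 -
                  Adiabatic.evolutionQ L T k * Adiabatic.stableAt L T 0‖ ≤
                C₀ c (Adiabatic.maxCount L) / (T * (1 - ℓ)) ∧
              ‖Adiabatic.evolution L T k * Adiabatic.projAt L T 0 -
                  Adiabatic.evolutionP L T k * Adiabatic.projAt L T 0‖ ≤
                C₀ c (Adiabatic.maxCount L) / (T * (1 - ℓ)) ∧
              ‖Adiabatic.evolution L T k * Adiabatic.stableAt L T 0‖ ≤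
                C₀ c (Adiabatic.maxCount L) / (T * (1 - ℓ)) + 2 * ℓ ^ k ∧
              ‖Adiabatic.evolutionQ L T k * Adiabatic.stableAt L T 0‖ ≤ 2 * ℓ ^ k := by
  refine ⟨fun c _ => 2 * c + 1, Adiabatic.leakConst, Adiabatic.adiabaticConst,
    fun c N hc => ⟨by linarith, by linarith, Adiabatic.leakConst_pos hc⟩,
    fun c N ε hc hε => Adiabatic.adiabaticConst_pos hc hε, ?_⟩
  intro X _ _ _ L ε ℓ h
  refine ⟨h.exists_isLabelling, fun e he => ⟨fun j => ⟨h.contDiffOn_eig he j,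
    h.contDiffOn_eigProj he j⟩, h.exists_derivBound he, fun c hc hb T hT => ?_⟩⟩
  have : CompleteSpace X := FiniteDimensional.complete ℂ X
  have hT' : 0 < T := by exact_mod_cast (show (0 : ℝ) < T by linarith)
  have hslow := h.isSlowLabelling (T := T) he hb (by rw [div_lt_one] <;> linarith)
  refine ⟨fun k hk j => (hslow.norm_sub_le k hk j).trans_lt hslow.lt_one, fun k hk => ?_⟩
  have hequiv := hslow.isFamilyEquiv_adiabaticMap hk
  exact ⟨h.max_norm_adiabaticMap_le he hc hb hT hk,
    hequiv.inv_map.trans (he.projAt_eq T.zero_le).symm,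
    hequiv.map_inv.trans (he.projAt_eq hk).symm, hequiv.map_mul, hequiv.inv_mul,
    hequiv.map_mul_stableAt he, hequiv.stableAt_mul_inv he,
    h.norm_evolution_sub_adiabaticMap_le he hc hb hT hk,
    h.norm_evolutionP_sub_le_adiabaticConst he hc hb hT hk,
    h.norm_evolution_sub_sub_le he hc hb hT' hk,
    h.norm_evolution_mul_projAt_sub_le he hc hb hT' hk,
    h.norm_evolution_mul_stableAt_le he hc hb hT' hk,
    h.norm_evolutionQ_mul_stableAt_le he hc hb hk⟩
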